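/- Let $m>1$, let $N\ge 1$ be an integer, and let $\ell\in\mathbb N_0$, with $\ell\in\{0,1\}$ if $N=1$. Put $\mu_\ell=\ell(\ell+N-2)$ and let $\rho_*\ge 0$ be given by $\frac{2m}{m-1}\rho_*(r)^{m-1}=(1-r^2)_+$. Let $I=(0,1)$ if $N\ge2$ and $I=(-1,1)$ if $N=1$; in the case $N=1$ all functions below are required to be even (if $\ell=0$) or odd (if $\ell=1$) on $I$. Let $$H^1_\ell=\Big\{f\in H^1_{\mathrm{loc}}(I):\ \int_I\Big((f')^2+\frac{\mu_\ell}{r^2}f^2\Big)\rho_*\,r^{N-1}\,dr<\infty\Big\},$$ where, if $\ell=0$, functions that differ by a constant are identified. With weak derivatives let $$\mathcal H_\ell f=-m\rho_*^{m-1}\Big(f''+\frac{N-1}{r}f'-\frac{\mu_\ell}{r^2}f\Big)+rf',$$ $$\mathcal D(\mathcal H_\ell)=\big\{f\in H^3_{\mathrm{loc}}(I)\cap H^1_\ell:\ \mathcal H_\ell f\in H^1_\ell,\ \rho_*f'|_{r=1}=0\big\},$$ where $\rho_*f'|_{r=1}=0$ means that $\int_I\rho_*f'g'r^{N-1}\,dr=-\int_I(\rho_*f'r^{N-1})'g\,dr$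 (both integrals being absolutely convergent) for all $g\in H^1_\ell$. For $k\in\mathbb N_0$ let $$\lambda_{\ell k}=\ell+2k+2k\Big(k+\ell+\frac N2-1\Big)(m-1),$$ $$f_{\ell k}(r)=r^\ell F\Big(-k,\frac1{m-1}+\ell+\frac N2-1+k;\ell+\frac N2;r^2\Big),$$ where $F(-k,b;c;z)=\sum_{j=0}^k\frac{(-k)_j(b)_j}{(c)_j\,j!}z^j$ and $(s)_j=s(s+1)\cdots(s+j-1)$, $(s)_0=1$. (i) A real number $\lambda$ is an eigenvalue of $\mathcal H_\ell$ on $\mathcal D(\mathcal H_\ell)$, i.e. $\mathcal H_\ell f=\lambda f$ in $H^1_\ell$ for some $f\in\mathcal D(\mathcal H_\ell)$ with $f\neq0$ in $H^1_\ell$, if and only if $\lambda=\lambda_{\ell k}$ for some $k\in\mathbb N_0$ with $(\ell,k)\neq(0,0)$. (ii) For every $k\in\mathbb N_0$ with $(\ell,k)\ne(0,0)$, the eigenfunctions of $\mathcal H_\ell$ for the eigenvalue $\lambda_{\ell k}$ are exactly the nonzero multiples of $f_{\ell k}$ (as elements of $H^1_\ell$). (iii) Let $\lambda\in\mathbb R$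 and let $f\in C^2(I)$, $f\not\equiv0$, solve $$f''+\Big(\frac{N-1}{r}-\frac{2}{m-1}\frac{r}{1-r^2}\Big)f'+\Big(\frac{2\lambda}{m-1}\frac{1}{1-r^2}-\frac{\mu_\ell}{r^2}\Big)f=0\quad\text{in }I .$$ Unless $\lambda=\lambda_{\ell k}$ and $f$ is a multiple of $f_{\ell k}$ for some $k\in\mathbb N_0$, either $\int_0^{1/2}\big((f')^2+\frac{\mu_\ell}{r^2}f^2\big)\rho_*r^{N-1}\,dr=\infty$, or $\rho_*(r)f'(r)$ does not tend to $0$ as $r\uparrow1$. -/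

import Mathlib

open MeasureTheory Set Filter Topology
open scoped ContDiff

noncomputable section

/-! ### Weak derivatives and local Sobolev spaces on a subset of the line

Functions are represented by maps `ℝ → ℝ`; only their values almost everywhere on the set matter. -/

/-- `g` is a weak derivative of `f` on the open set `I`. -/
def IsWeakDeriv (I : Set ℝ) (f g : ℝ → ℝ) : Prop :=
  LocallyIntegrableOn f I ∧ LocallyIntegrableOn g I ∧
    ∀ φ : ℝ → ℝ, ContDiff ℝ ∞ φ → HasCompactSupport φ → tsupport φ ⊆ I →
      ∫ r in I, f r * deriv φ r = - ∫ r in I, g r * φ r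

open Classical in
/-- The weak derivative of `f` on `I` (unique up to null sets), and `0` if there is none. -/
def weakDeriv (I : Set ℝ) (f : ℝ → ℝ) : ℝ → ℝ :=
  if h : ∃ g, IsWeakDeriv I f g then h.choose else 0

/-- `f ∈ L²_loc(I)`. -/
def MemL2Loc (I : Set ℝ) (f : ℝ → ℝ) : Prop :=
  ∀ K : Set ℝ, K ⊆ I → IsCompact K → MemLp f 2 (volume.restrict K)

/-- `f ∈ H^k_loc(I)`: all weak derivatives of order `0, …, k` exist and are in `L²_loc(I)`. -/
def MemSobolevLoc (I : Set ℝ) : ℕ → (ℝ → ℝ) → Prop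
  | 0, f => MemL2Loc I f
  | k + 1, f => MemL2Loc I f ∧ ∃ g, IsWeakDeriv I f g ∧ MemSobolevLoc I k g

/-! ### The radial operators -/

/-- The Barenblatt profile, i.e. the `ρ ≥ 0` with `2m/(m-1) ρ^(m-1) = (1 - r²)₊`. -/
def barenblatt (m r : ℝ) : ℝ :=
  ((m - 1) / (2 * m) * max (1 - r ^ 2) 0) ^ (1 / (m - 1))

/-- The eigenvalue `μ_ℓ = ℓ(ℓ + N - 2)` of minus the spherical Laplacian. -/
def sphericalEigenvalue (N ℓ : ℕ) : ℝ := (ℓ : ℝ) * ((ℓ : ℝ) + (N : ℝ) - 2)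

/-- The interval on which mode functions live: `(0,1)` for `N ≥ 2`.  For `N = 1` the modes are the
even (`ℓ = 0`) and the odd (`ℓ = 1`) functions on the whole ball `(-1,1)`. -/
def modeInterval (N : ℕ) : Set ℝ := if N = 1 then Ioo (-1) 1 else Ioo 0 1

/-- For `N = 1`: `f` is even on `(-1,1)` if `ℓ = 0`, and odd if `ℓ = 1`. No condition if `N ≥ 2`. -/
def HasModeParity (N ℓ : ℕ) (f : ℝ → ℝ) : Prop :=
  N = 1 → ∀ᵐ r ∂volume.restrict (modeInterval N), f (-r) = (-1) ^ ℓ * f r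

/-- The energy density `((f')² + μ_ℓ/r² f²) ρ_* r^(N-1)` for given `f` and `f'`. -/
def modeEnergyDensity (N ℓ : ℕ) (m : ℝ) (f f' : ℝ → ℝ) (r : ℝ) : ℝ :=
  ((f' r) ^ 2 + sphericalEigenvalue N ℓ / r ^ 2 * (f r) ^ 2) * barenblatt m r * r ^ (N - 1)

/-- `f ∈ H¹_ℓ`. -/
def MemModeSpace (N ℓ : ℕ) (m : ℝ) (f : ℝ → ℝ) : Prop :=
  MemSobolevLoc (modeInterval N) 1 f ∧ HasModeParity N ℓ f ∧
    IntegrableOn (modeEnergyDensity N ℓ m f (weakDeriv (modeInterval N) f)) (modeInterval N)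

/-- `f` and `g` are the same element of `H¹_ℓ`: they agree almost everywhere, up to an additive
constant if `ℓ = 0`. -/
def ModeEq (N ℓ : ℕ) (f g : ℝ → ℝ) : Prop :=
  ∃ c : ℝ, (ℓ ≠ 0 → c = 0) ∧ ∀ᵐ r ∂volume.restrict (modeInterval N), f r = g r + c

/-- `H_ℓ f = -m ρ_*^(m-1) (f'' + (N-1)/r f' - μ_ℓ/r² f) + r f'` with weak derivatives. -/
def radialOp (N ℓ : ℕ) (m : ℝ) (f : ℝ → ℝ) (r : ℝ) : ℝ :=
  let I := modeInterval N;
  -m * barenblatt m r ^ (m - 1) *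
      (weakDeriv I (weakDeriv I f) r + ((N : ℝ) - 1) / r * weakDeriv I f r
        - sphericalEigenvalue N ℓ / r ^ 2 * f r)
    + r * weakDeriv I f r

/-- The asymptotic boundary condition `ρ_* f'|_{r=1} = 0`:
`∫ ρ_* f' g' r^(N-1) dr = -∫ (ρ_* f' r^(N-1))' g dr` for all `g ∈ H¹_ℓ`. -/
def AsymptoticBC (N ℓ : ℕ) (m : ℝ) (f : ℝ → ℝ) : Prop :=
  let I := modeInterval N
  let flux : ℝ → ℝ := fun r => barenblatt m r * weakDeriv I f r * r ^ (N - 1)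
  ∀ g : ℝ → ℝ, MemModeSpace N ℓ m g →
    IntegrableOn (fun r => barenblatt m r * weakDeriv I f r * weakDeriv I g r * r ^ (N - 1)) I ∧
    IntegrableOn (fun r => weakDeriv I flux r * g r) I ∧
    ∫ r in I, barenblatt m r * weakDeriv I f r * weakDeriv I g r * r ^ (N - 1)
      = - ∫ r in I, weakDeriv I flux r * g r

/-- The domain `D(H_ℓ)`. -/
def MemRadialDomain (N ℓ : ℕ) (m : ℝ) (f : ℝ → ℝ) : Prop :=
  MemSobolevLoc (modeInterval N) 3 f ∧ MemModeSpace N ℓ m f ∧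
    MemModeSpace N ℓ m (radialOp N ℓ m f) ∧ AsymptoticBC N ℓ m f

/-- `f ∈ D(H_ℓ)` is an eigenfunction: `f ≠ 0` and `H_ℓ f = lam f` in `H¹_ℓ`. -/
def IsRadialEigenfunction (N ℓ : ℕ) (m lam : ℝ) (f : ℝ → ℝ) : Prop :=
  MemRadialDomain N ℓ m f ∧ ¬ ModeEq N ℓ f 0 ∧
    ModeEq N ℓ (radialOp N ℓ m f) (fun r => lam * f r)

/-- `lam` is an eigenvalue of `H_ℓ` on `D(H_ℓ)`. -/
def IsRadialEigenvalue (N ℓ : ℕ) (m lam : ℝ) : Prop :=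
  ∃ f : ℝ → ℝ, IsRadialEigenfunction N ℓ m lam f

/-- `f` is a classical solution on the mode interval (of the right parity if `N = 1`) of
`f'' + ((N-1)/r - 2/(m-1) r/(1-r²)) f' + (2 lam/(m-1) 1/(1-r²) - μ_ℓ/r²) f = 0`. -/
def IsRadialODESolution (N ℓ : ℕ) (m lam : ℝ) (f : ℝ → ℝ) : Prop :=
  ContDiffOn ℝ 2 f (modeInterval N) ∧ HasModeParity N ℓ f ∧
    ∀ r ∈ modeInterval N,
      deriv (deriv f) r
        + (((N : ℝ) - 1) / r - 2 / (m - 1) * (r / (1 - r ^ 2))) * deriv f r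
        + (2 * lam / (m - 1) * (1 / (1 - r ^ 2)) - sphericalEigenvalue N ℓ / r ^ 2) * f r = 0

/-! ### The explicit eigenvalues and eigenfunctions -/

/-- The terminating hypergeometric series `F(-k, b; c; z)`. -/
def hypergeometricPoly (k : ℕ) (b c z : ℝ) : ℝ :=
  ∑ j ∈ Finset.range (k + 1),
    (ascPochhammer ℝ j).eval (-(k : ℝ)) * (ascPochhammer ℝ j).eval b
      / ((ascPochhammer ℝ j).eval c * (j.factorial : ℝ)) * z ^ j

/-- `λ_{ℓk} = ℓ + 2k + 2k(k + ℓ + N/2 - 1)(m - 1)`. -/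
def radialEigenvalue (N ℓ k : ℕ) (m : ℝ) : ℝ :=
  (ℓ : ℝ) + 2 * k + 2 * k * ((k : ℝ) + ℓ + (N : ℝ) / 2 - 1) * (m - 1)

/-- `f_{ℓk}(r) = r^ℓ F(-k, 1/(m-1) + ℓ + N/2 - 1 + k; ℓ + N/2; r²)`. -/
def radialEigenfunction (N ℓ k : ℕ) (m r : ℝ) : ℝ :=
  r ^ ℓ * hypergeometricPoly k (1 / (m - 1) + ℓ + (N : ℝ) / 2 - 1 + k) (ℓ + (N : ℝ) / 2) (r ^ 2)

end

/-! The proof needs neither hypergeometric asymptotics nor ODE theory: it tests the equation with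
polynomials and reads off moments. The operator is symmetric for the weight `modeWeight`, because
`(ρ_* r^(N-1) f')'` equals `μ_ℓ/r² ρ_* r^(N-1) f` minus a constant multiple of the weight times `H_ℓ
f` (`flux_identity`). On functions `r^ℓ Q(r²)` it is triangular: it sends `r^(ℓ+2j)` to `λ_{ℓj}
r^(ℓ+2j) - d_j r^(ℓ+2j-2)` with `d_0 = 0` (`modeOp_X_pow`). The coefficients of `F` are exactly
those that solve the resulting two-term recursion, so `f_{ℓk}` is an eigenfunction
(`modeOp_eigenPoly`).

Conversely, let `F` solve `H_ℓ F = λ F` in the very weak sense, tested against all `r^ℓ Q(r²)`. Its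
moments `M_j` against `r^(ℓ+2j)` satisfy `(λ - λ_{ℓj}) M_j = -d_j M_{j-1}` (`moment_recursion`). If
`λ` is no `λ_{ℓj}`, all moments vanish, and `F = 0` since polynomials in `r²` are dense. If `λ =
λ_{ℓk}`, the `λ_{ℓj}` being distinct, all moments vanish as soon as `M_k` does; subtracting a
multiple of `f_{ℓk}` to kill `M_k` shows that `F` is that multiple
(`IsVeryWeakEigenfunction.classification`).

What remains is to reach the very weak form by two integrations by parts without boundary terms.
Finite energy forces a growth bound (`IsTame`) slightly better than `1/ρ_*` at `r = 1`, which makes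
`ρ_* r^(N-1) F p'` vanish at both ends for every mode polynomial `p` (`integral_flux_modePoly`). The
other flux, `ρ_* r^(N-1) f' p`, is removed by the asymptotic boundary condition for operator
eigenfunctions. For classical solutions it is removed at `1` by the hypothesis, and at the left end
by parity (`N = 1`) or by finiteness of the energy (`N ≥ 2`). -/

/-! ### Locally absolutely continuous functions and weak derivatives on an interval. -/

/-- `G` is locally absolutely continuous on `I` with derivative `g`. -/
def IsPrimitiveOn (I : Set ℝ) (G g : ℝ → ℝ) : Prop :=
  ∀ x ∈ I, ∀ y ∈ I, IntervalIntegrable g volume x y ∧ ∫ t in x..y, g t = G y - G x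

theorem IsPrimitiveOn.mono {I J : Set ℝ} {G g : ℝ → ℝ} (h : IsPrimitiveOn I G g) (hJ : J ⊆ I) :
    IsPrimitiveOn J G g := fun x hx y hy => h x (hJ hx) y (hJ hy)

theorem IsPrimitiveOn.of_hasDerivAt {I : Set ℝ} (hI : I.OrdConnected) {G g : ℝ → ℝ}
    (h : ∀ x ∈ I, HasDerivAt G (g x) x) (hg : ContinuousOn g I) : IsPrimitiveOn I G g := by
  intro x hx y hy
  have hs : uIcc x y ⊆ I := hI.uIcc_subset hx hy
  have hi : IntervalIntegrable g volume x y := (hg.mono hs).intervalIntegrable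
  exact ⟨hi, intervalIntegral.integral_eq_sub_of_hasDerivAt (fun t ht => h t (hs ht)) hi⟩

/-- Product rule in the absolutely continuous class. On each compact subinterval both factors are a
constant plus an integral, hence absolutely continuous, with the prescribed derivatives almost
everywhere. -/
theorem IsPrimitiveOn.mul {I : Set ℝ} (hI : I.OrdConnected) {G g H h : ℝ → ℝ}
    (hG : IsPrimitiveOn I G g) (hH : IsPrimitiveOn I H h) :
    IsPrimitiveOn I (fun x => G x * H x) (fun x => g x * H x + G x * h x) := by
  intro x hx y hy
  have hs : uIcc x y ⊆ I := hI.uIcc_subset hx hy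
  obtain ⟨hgi, hge⟩ := hG x hx y hy
  obtain ⟨hhi, hhe⟩ := hH x hx y hy
  have eG : ∀ t ∈ uIcc x y, G t = G x + ∫ s in x..t, g s := fun t ht => by
    rw [(hG x hx t (hs ht)).2]; ring
  have eH : ∀ t ∈ uIcc x y, H t = H x + ∫ s in x..t, h s := fun t ht => by
    rw [(hH x hx t (hs ht)).2]; ring
  have acc : ∀ c : ℝ, AbsolutelyContinuousOnInterval (fun _ : ℝ => c) x y := fun c =>
    ContDiffOn.absolutelyContinuousOnInterval contDiffOn_const
  have aG := (acc (G x)).fun_add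
    (hgi.absolutelyContinuousOnInterval_intervalIntegral (c := x) left_mem_uIcc)
  have aH := (acc (H x)).fun_add
    (hhi.absolutelyContinuousOnInterval_intervalIntegral (c := x) left_mem_uIcc)
  have key := aG.integral_deriv_mul_eq_sub aH
  have cG : ContinuousOn G (uIcc x y) := aG.continuousOn.congr eG
  have cH : ContinuousOn H (uIcc x y) := aH.continuousOn.congr eH
  refine ⟨(hgi.mul_continuousOn cH).add (hhi.continuousOn_mul cG), ?_⟩
  simp only [← eG y right_mem_uIcc, ← eH y right_mem_uIcc, intervalIntegral.integral_same,
    add_zero] at key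
  rw [← key]
  apply intervalIntegral.integral_congr_ae
  filter_upwards [hgi.ae_hasDerivAt_integral, hhi.ae_hasDerivAt_integral] with t h1 h2 ht
  have ht' := uIoc_subset_uIcc ht
  rw [((h1 ht' x left_mem_uIcc).const_add (G x)).deriv,
    ((h2 ht' x left_mem_uIcc).const_add (H x)).deriv, ← eG t ht', ← eH t ht']

theorem exists_subset_Icc_of_isCompact {I K : Set ℝ} (hne : I.Nonempty) (hK : IsCompact K)
    (hKI : K ⊆ I) : ∃ x ∈ I, ∃ y ∈ I, x ≤ y ∧ K ⊆ Icc x y := by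
  rcases K.eq_empty_or_nonempty with rfl | h
  · obtain ⟨x, hx⟩ := hne
    exact ⟨x, hx, x, hx, le_rfl, empty_subset _⟩
  · refine ⟨sInf K, hKI (hK.sInf_mem h), sSup K, hKI (hK.sSup_mem h), ?_, fun z hz =>
      ⟨csInf_le hK.bddBelow hz, le_csSup hK.bddAbove hz⟩⟩
    obtain ⟨z, hz⟩ := h
    exact (csInf_le hK.bddBelow hz).trans (le_csSup hK.bddAbove hz)

theorem IsPrimitiveOn.locallyIntegrableOn {a b : ℝ} {G g : ℝ → ℝ}
    (h : IsPrimitiveOn (Ioo a b) G g) : LocallyIntegrableOn g (Ioo a b) := by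
  rcases (Ioo a b).eq_empty_or_nonempty with he | hne
  · rw [he]; intro x hx; exact hx.elim
  rw [locallyIntegrableOn_iff isOpen_Ioo.isLocallyClosed]
  intro K hK hKc
  obtain ⟨x, hx, y, hy, hxy, hs⟩ := exists_subset_Icc_of_isCompact hne hKc hK
  exact (((intervalIntegrable_iff_integrableOn_Icc_of_le hxy).1 (h x hx y hy).1)).mono_set hs

theorem IsPrimitiveOn.continuousOn {a b : ℝ} {G g : ℝ → ℝ} (h : IsPrimitiveOn (Ioo a b) G g) :
    ContinuousOn G (Ioo a b) := by
  intro x hx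
  obtain ⟨u, hu1, hu2⟩ := exists_between hx.1
  obtain ⟨w, hw1, hw2⟩ := exists_between hx.2
  have hu : u ∈ Ioo a b := ⟨hu1, hu2.trans hx.2⟩
  have hw : w ∈ Ioo a b := ⟨hx.1.trans hw1, hw2⟩
  have hac := (h u hu w hw).1.absolutelyContinuousOnInterval_intervalIntegral (c := u) left_mem_uIcc
  have hc := hac.continuousOn.add (continuousOn_const (c := G u))
  have huw : u ≤ w := (hu2.trans hw1).le
  rw [uIcc_of_le huw] at hc
  have h2 : ContinuousOn G (Icc u w) := hc.congr fun t ht => by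
    have := (h u hu t ⟨hu1.trans_le ht.1, ht.2.trans_lt hw2⟩).2
    simp only [this, Pi.add_apply]; ring
  exact (h2.continuousAt (Icc_mem_nhds hu2 hw1)).continuousWithinAt

theorem setIntegral_Ioo_eq_intervalIntegral {a b x y : ℝ} {F : ℝ → ℝ} (hx : x ∈ Ioo a b)
    (hy : y ∈ Ioo a b) (hxy : x ≤ y) (hF : ∀ t ∈ Ioo a b, t ∉ Icc x y → F t = 0) :
    ∫ t in Ioo a b, F t = ∫ t in x..y, F t := by
  rw [intervalIntegral.integral_of_le hxy, ← integral_Icc_eq_integral_Ioc]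
  exact (setIntegral_eq_of_subset_of_forall_sdiff_eq_zero measurableSet_Ioo
    (fun t ht => ⟨hx.1.trans_le ht.1, ht.2.trans_lt hy.2⟩) (fun t ht => hF t ht.1 ht.2))

theorem IsPrimitiveOn.isWeakDeriv {a b : ℝ} {G g : ℝ → ℝ} (h : IsPrimitiveOn (Ioo a b) G g) :
    IsWeakDeriv (Ioo a b) G g := by
  refine ⟨h.continuousOn.locallyIntegrableOn measurableSet_Ioo, h.locallyIntegrableOn, ?_⟩
  intro φ hφ hc hs
  rcases (Ioo a b).eq_empty_or_nonempty with he | hne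
  · simp [he]
  obtain ⟨x, hx, y, hy, hxy, hK⟩ := exists_subset_Icc_of_isCompact hne hc hs
  -- The interval is enlarged strictly on both sides of the support, so that `φ` vanishes at the end
  -- points `u` and `w`.
  obtain ⟨u, hu1, hu2⟩ := exists_between hx.1
  obtain ⟨w, hw1, hw2⟩ := exists_between hy.2
  have hu : u ∈ Ioo a b := ⟨hu1, hu2.trans hx.2⟩
  have hw : w ∈ Ioo a b := ⟨hy.1.trans hw1, hw2⟩
  have huw : u ≤ w := (hu2.le.trans hxy).trans hw1.le
  have hz : ∀ t, t ∉ Icc x y → φ t = 0 := fun t ht =>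
    image_eq_zero_of_notMem_tsupport fun h' => ht (hK h')
  have hz' : ∀ t, t ∉ Icc x y → deriv φ t = 0 := fun t ht =>
    image_eq_zero_of_notMem_tsupport fun h' => ht (hK (tsupport_deriv_subset h'))
  have hout : ∀ t, t ∉ Icc u w → t ∉ Icc x y := fun t ht h' =>
    ht ⟨hu2.le.trans h'.1, h'.2.trans hw1.le⟩
  have hφp : IsPrimitiveOn (Ioo a b) φ (deriv φ) := IsPrimitiveOn.of_hasDerivAt ordConnected_Ioo
    (fun t _ => (hφ.differentiable (by simp) t).hasDerivAt)
    (hφ.continuous_deriv (by simp)).continuousOn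
  have hm := (h.mul ordConnected_Ioo hφp u hu w hw).2
  beta_reduce at hm
  rw [hz u (fun h' => absurd h'.1 (not_le.2 hu2)), hz w (fun h' => absurd h'.2 (not_le.2 hw1))] at hm
  rw [setIntegral_Ioo_eq_intervalIntegral hu hw huw (fun t _ ht => by rw [hz' t (hout t ht)]; simp),
    setIntegral_Ioo_eq_intervalIntegral hu hw huw (fun t _ ht => by rw [hz t (hout t ht)]; simp)]
  rw [intervalIntegral.integral_add] at hm
  · linarith
  · exact (h u hu w hw).1.mul_continuousOn hφ.continuous.continuousOn
  · exact (hφp u hu w hw).1.continuousOn_mul (h.continuousOn.mono (by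
      rw [uIcc_of_le huw]; exact Icc_subset_Ioo hu1 hw2))

theorem IsWeakDeriv.ae_unique {a b : ℝ} {f g h : ℝ → ℝ} (hg : IsWeakDeriv (Ioo a b) f g)
    (hh : IsWeakDeriv (Ioo a b) f h) : g =ᵐ[volume.restrict (Ioo a b)] h := by
  have := isOpen_Ioo.ae_eq_zero_of_integral_contDiff_smul_eq_zero (μ := volume)
    (U := Ioo a b) (f := g - h) (hg.2.1.sub hh.2.1) ?_
  · rw [EventuallyEq, ae_restrict_iff' measurableSet_Ioo]
    filter_upwards [this] with x hx hxI
    have := hx hxI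
    simp only [Pi.sub_apply] at this
    linarith
  · intro φ hφ hc hs
    have e1 := hg.2.2 φ hφ hc hs
    have e2 := hh.2.2 φ hφ hc hs
    have int : ∀ k : ℝ → ℝ, LocallyIntegrableOn k (Ioo a b) →
        IntegrableOn (fun x => k x * φ x) (Ioo a b) := by
      intro k hk
      have h1 : IntegrableOn k (tsupport φ) := hk.integrableOn_compact_subset hs hc
      have h2 : IntegrableOn (fun x => k x * φ x) (tsupport φ) :=
        h1.mul_continuousOn hφ.continuous.continuousOn hc
      exact ((integrableOn_iff_integrable_of_support_subset (by
        intro x hx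
        apply subset_tsupport
        intro h0
        exact hx (by simp [h0]))).1 h2).integrableOn
    have : ∫ x, φ x • (g - h) x = ∫ x in Ioo a b, (g x * φ x - h x * φ x) := by
      rw [← setIntegral_eq_integral_of_forall_compl_eq_zero (s := Ioo a b)]
      · refine integral_congr_ae (Eventually.of_forall fun x => ?_)
        simp only [Pi.sub_apply, smul_eq_mul]; ring
      · intro x hx
        rw [image_eq_zero_of_notMem_tsupport (fun h' => hx (hs h'))]; simp
    rw [this, integral_sub (int g hg.2.1) (int h hh.2.1)]
    linarith

theorem weakDeriv_spec {I : Set ℝ} {f g : ℝ → ℝ} (h : IsWeakDeriv I f g) :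
    IsWeakDeriv I f (weakDeriv I f) := by
  have he : ∃ g, IsWeakDeriv I f g := ⟨g, h⟩
  rw [weakDeriv, dif_pos he]
  exact he.choose_spec

theorem weakDeriv_ae_eq {a b : ℝ} {f g : ℝ → ℝ} (h : IsWeakDeriv (Ioo a b) f g) :
    weakDeriv (Ioo a b) f =ᵐ[volume.restrict (Ioo a b)] g :=
  (weakDeriv_spec h).ae_unique h

theorem locallyIntegrableOn_congr_ae_Ioo {a b : ℝ} {f g : ℝ → ℝ}
    (hf : LocallyIntegrableOn f (Ioo a b)) (h : f =ᵐ[volume.restrict (Ioo a b)] g) :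
    LocallyIntegrableOn g (Ioo a b) := by
  rw [locallyIntegrableOn_iff isOpen_Ioo.isLocallyClosed] at hf ⊢
  intro K hK hc
  exact (hf K hK hc).congr_fun_ae (ae_restrict_of_ae_restrict_of_subset hK h)

theorem IsWeakDeriv.congr_ae {a b : ℝ} {f f' g g' : ℝ → ℝ} (h : IsWeakDeriv (Ioo a b) f g)
    (hf : f =ᵐ[volume.restrict (Ioo a b)] f') (hg : g =ᵐ[volume.restrict (Ioo a b)] g') :
    IsWeakDeriv (Ioo a b) f' g' := by
  refine ⟨locallyIntegrableOn_congr_ae_Ioo h.1 hf, locallyIntegrableOn_congr_ae_Ioo h.2.1 hg, ?_⟩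
  intro φ h1 h2 h3
  have e1 : ∫ r in Ioo a b, f' r * deriv φ r = ∫ r in Ioo a b, f r * deriv φ r :=
    integral_congr_ae (by filter_upwards [hf] with x hx; rw [hx])
  have e2 : ∫ r in Ioo a b, g' r * φ r = ∫ r in Ioo a b, g r * φ r :=
    integral_congr_ae (by filter_upwards [hg] with x hx; rw [hx])
  rw [e1, e2, h.2.2 φ h1 h2 h3]

/-- The equality is literal, not just almost everywhere: both sides choose from the same predicate.
-/
theorem weakDeriv_congr_ae {a b : ℝ} {f f' : ℝ → ℝ} (hf : f =ᵐ[volume.restrict (Ioo a b)] f') :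
    weakDeriv (Ioo a b) f = weakDeriv (Ioo a b) f' := by
  have : IsWeakDeriv (Ioo a b) f = IsWeakDeriv (Ioo a b) f' := by
    ext g
    exact ⟨fun h => h.congr_ae hf (EventuallyEq.refl _ _),
      fun h => h.congr_ae hf.symm (EventuallyEq.refl _ _)⟩
  classical
  have key : ∀ P Q : (ℝ → ℝ) → Prop, P = Q →
      (if h : ∃ g, P g then h.choose else 0) = (if h : ∃ g, Q g then h.choose else 0) := by
    rintro P _ rfl; rfl
  unfold weakDeriv
  convert! key _ _ this

theorem MemSobolevLoc.congr_ae {a b : ℝ} {k : ℕ} {f f' : ℝ → ℝ}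
    (h : MemSobolevLoc (Ioo a b) k f)
    (hf : f =ᵐ[volume.restrict (Ioo a b)] f') : MemSobolevLoc (Ioo a b) k f' := by
  have h0 : ∀ {f}, MemL2Loc (Ioo a b) f → f =ᵐ[volume.restrict (Ioo a b)] f' →
      MemL2Loc (Ioo a b) f' := fun h hf K hK hc =>
    (h K hK hc).ae_eq (ae_restrict_of_ae_restrict_of_subset hK hf)
  cases k with
  | zero => exact h0 h hf
  | succ k =>
    obtain ⟨h1, g, hg, h2⟩ := h
    exact ⟨h0 h1 hf, g, hg.congr_ae hf (EventuallyEq.refl _ _), h2⟩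

theorem Continuous.memL2Loc {f : ℝ → ℝ} (hf : Continuous f) (I : Set ℝ) : MemL2Loc I f :=
  fun _ _ hc => by
    obtain ⟨C, hC⟩ := hc.exists_bound_of_continuousOn hf.continuousOn
    have : IsFiniteMeasure (volume.restrict ‹Set ℝ›) := ⟨by simpa using hc.measure_lt_top⟩
    exact MemLp.of_bound hf.aestronglyMeasurable C
      ((ae_restrict_iff' hc.measurableSet).2 (Eventually.of_forall hC))

theorem isWeakDeriv_deriv {f : ℝ → ℝ} (hf : ContDiff ℝ ∞ f) (a b : ℝ) :
    IsWeakDeriv (Ioo a b) f (deriv f) :=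
  (IsPrimitiveOn.of_hasDerivAt ordConnected_Ioo
    (fun t _ => (hf.differentiable (by simp) t).hasDerivAt)
    (hf.continuous_deriv (by simp)).continuousOn).isWeakDeriv

theorem ContDiff.memSobolevLoc {f : ℝ → ℝ} (hf : ContDiff ℝ ∞ f) (a b : ℝ) (k : ℕ) :
    MemSobolevLoc (Ioo a b) k f := by
  induction k generalizing f with
  | zero => exact hf.continuous.memL2Loc _
  | succ k ih =>
    exact ⟨hf.continuous.memL2Loc _, deriv f, isWeakDeriv_deriv hf a b,
      ih (contDiff_infty_iff_deriv.1 hf).2⟩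

/-- The du Bois-Reymond lemma. With a bump `η` of integral one, `ψ - (∫ ψ) η` has mean zero, so its
primitive is again a test function. Hence `h` acts on test functions as the constant `∫ h η`. -/
theorem ae_eq_const_of_integral_mul_deriv_eq_zero {a b : ℝ} (hab : a < b) {h : ℝ → ℝ}
    (hh : LocallyIntegrableOn h (Ioo a b))
    (h0 : ∀ φ : ℝ → ℝ, ContDiff ℝ ∞ φ → HasCompactSupport φ → tsupport φ ⊆ Ioo a b →
      ∫ r in Ioo a b, h r * deriv φ r = 0) :
    ∃ c : ℝ, h =ᵐ[volume.restrict (Ioo a b)] fun _ => c := by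
  let B : ContDiffBump ((a + b) / 2) := ⟨(b - a) / 8, (b - a) / 4, by linarith, by linarith⟩
  set η : ℝ → ℝ := B.normed volume with hη
  have ηc : ContDiff ℝ ∞ η := B.contDiff_normed
  have ηK : HasCompactSupport η := B.hasCompactSupport_normed
  have ηs : tsupport η ⊆ Ioo a b := by
    rw [hη, B.tsupport_normed_eq, Real.closedBall_eq_Icc]
    intro x hx
    have h1 : (a + b) / 2 - (b - a) / 4 ≤ x := hx.1
    have h2 : x ≤ (a + b) / 2 + (b - a) / 4 := hx.2
    constructor <;> linarith
  have ηi : ∫ x, η x = 1 := B.integral_normed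
  have int : ∀ (k φ : ℝ → ℝ), LocallyIntegrableOn k (Ioo a b) → Continuous φ →
      HasCompactSupport φ → tsupport φ ⊆ Ioo a b → Integrable (fun x => k x * φ x) := by
    intro k φ hk hφ hc hs
    have h1 : IntegrableOn k (tsupport φ) := hk.integrableOn_compact_subset hs hc
    have h2 : IntegrableOn (fun x => k x * φ x) (tsupport φ) :=
      h1.mul_continuousOn hφ.continuousOn hc
    exact (integrableOn_iff_integrable_of_support_subset (by
      intro x hx
      apply subset_tsupport
      intro h0
      exact hx (by simp [h0]))).1 h2
  have full : ∀ (k φ : ℝ → ℝ), tsupport φ ⊆ Ioo a b →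
      ∫ x in Ioo a b, k x * φ x = ∫ x, k x * φ x := fun k φ hs =>
    setIntegral_eq_integral_of_forall_compl_eq_zero fun x hx => by
      rw [image_eq_zero_of_notMem_tsupport (fun h' => hx (hs h')), mul_zero]
  refine ⟨∫ x, h x * η x, ?_⟩
  set c := ∫ x, h x * η x with hc
  have main : ∀ ψ : ℝ → ℝ, ContDiff ℝ ∞ ψ → HasCompactSupport ψ → tsupport ψ ⊆ Ioo a b →
      ∫ x, h x * ψ x = c * ∫ x, ψ x := by
    intro ψ hψ hψK hψs
    set d := ∫ x, ψ x with hd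
    have ψint : Integrable ψ := hψ.continuous.integrable_of_hasCompactSupport hψK
    have ηint : Integrable η := ηc.continuous.integrable_of_hasCompactSupport ηK
    set θ : ℝ → ℝ := fun x => ψ x - d * η x with hθ
    have θc : ContDiff ℝ ∞ θ := hψ.sub (contDiff_const.mul ηc)
    have θint : Integrable θ := ψint.sub (ηint.const_mul d)
    have θ0 : ∫ x, θ x = 0 := by
      simp only [hθ]
      rw [integral_sub ψint (ηint.const_mul d), integral_const_mul, ηi, ← hd]; ring
    obtain ⟨x0, hx0, y0, hy0, hxy, hs⟩ := exists_subset_Icc_of_isCompact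
      (nonempty_Ioo.2 hab) (hψK.isCompact.union ηK.isCompact) (union_subset hψs ηs)
    have θz : ∀ t, t ∉ Icc x0 y0 → θ t = 0 := by
      intro t ht
      simp only [hθ]
      rw [image_eq_zero_of_notMem_tsupport (fun h' => ht (hs (Or.inl h'))),
        image_eq_zero_of_notMem_tsupport (fun h' => ht (hs (Or.inr h')))]
      simp
    set φ : ℝ → ℝ := fun x => ∫ t in a..x, θ t with hφ
    have φd : ∀ x, HasDerivAt φ (θ x) x := fun x =>
      θc.continuous.integral_hasStrictDerivAt a x |>.hasDerivAt
    have dφ : deriv φ = θ := funext fun x => (φd x).deriv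
    have φc : ContDiff ℝ ∞ φ :=
      contDiff_infty_iff_deriv.2 ⟨fun x => (φd x).differentiableAt, dφ ▸ θc⟩
    have φz : ∀ t, t ∉ Icc x0 y0 → φ t = 0 := by
      intro t ht
      rcases lt_or_ge t x0 with h1 | h1
      · simp only [hφ]
        rw [intervalIntegral.integral_congr (g := fun _ => (0 : ℝ)) (fun s hs' => θz s ?_)]
        · simp
        · intro h2
          have := hs'.2
          have h3 : max a t < x0 := max_lt hx0.1 h1
          exact absurd h2.1 (not_le.2 (this.trans_lt h3))
      · have h2 : y0 < t := by
          by_contra hcon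
          exact ht ⟨h1, not_lt.1 hcon⟩
        simp only [hφ]
        have hat : a ≤ t := hy0.1.le.trans h2.le
        rw [intervalIntegral.integral_of_le hat, setIntegral_eq_integral_of_forall_compl_eq_zero, θ0]
        intro x hx
        apply θz
        intro hx'
        exact hx ⟨hx0.1.trans_le hx'.1, hx'.2.trans h2.le⟩
    have φs : tsupport φ ⊆ Icc x0 y0 := closure_minimal
      (fun t ht => by by_contra hcon; exact ht (φz t hcon)) isClosed_Icc
    have φK : HasCompactSupport φ := HasCompactSupport.intro isCompact_Icc φz
    have hI : Icc x0 y0 ⊆ Ioo a b := Icc_subset_Ioo hx0.1 hy0.2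
    have e := h0 φ φc φK (φs.trans hI)
    rw [full h _ ((tsupport_deriv_subset).trans (φs.trans hI)), dφ] at e
    have e2 : ∫ x, h x * θ x = (∫ x, h x * ψ x) - d * c := by
      rw [hc, ← integral_const_mul, ← integral_sub (int h ψ hh hψ.continuous hψK hψs)
        ((int h η hh ηc.continuous ηK ηs).const_mul d)]
      refine integral_congr_ae (Eventually.of_forall fun x => ?_)
      simp only [hθ]; ring
    rw [e2] at e
    linarith
  have := isOpen_Ioo.ae_eq_zero_of_integral_contDiff_smul_eq_zero (μ := volume)
    (U := Ioo a b) (f := h - fun _ : ℝ => c)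
    (hh.sub (continuousOn_const.locallyIntegrableOn measurableSet_Ioo)) ?_
  · rw [EventuallyEq, ae_restrict_iff' measurableSet_Ioo]
    filter_upwards [this] with x hx hxI
    have := hx hxI
    simp only [Pi.sub_apply] at this
    linarith
  · intro ψ hψ hK hs
    have ψint : Integrable ψ := hψ.continuous.integrable_of_hasCompactSupport hK
    have : ∫ x, ψ x • (h - fun _ : ℝ => c) x = ∫ x, (h x * ψ x - c * ψ x) := by
      refine integral_congr_ae (Eventually.of_forall fun x => ?_)
      simp only [Pi.sub_apply, smul_eq_mul]; ring
    rw [this, integral_sub (int h ψ hh hψ.continuous hK hs) (ψint.const_mul c),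
      integral_const_mul, main ψ hψ hK hs, sub_self]

theorem isPrimitiveOn_intervalIntegral {a b c : ℝ} {g : ℝ → ℝ} (hc : c ∈ Ioo a b)
    (hg : LocallyIntegrableOn g (Ioo a b)) :
    IsPrimitiveOn (Ioo a b) (fun x => ∫ t in c..x, g t) g := by
  have hi : ∀ x ∈ Ioo a b, ∀ y ∈ Ioo a b, IntervalIntegrable g volume x y := fun x hx y hy => by
    rw [intervalIntegrable_iff']
    exact hg.integrableOn_compact_subset (ordConnected_Ioo.uIcc_subset hx hy) isCompact_uIcc
  intro x hx y hy
  refine ⟨hi x hx y hy, ?_⟩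
  rw [intervalIntegral.integral_interval_sub_left (hi c hc y hy) (hi c hc x hx)]

/-- The difference between `f` and a primitive of `g` has weak derivative zero, hence is constant.
-/
theorem IsWeakDeriv.exists_isPrimitiveOn {a b : ℝ} (hab : a < b) {f g : ℝ → ℝ}
    (h : IsWeakDeriv (Ioo a b) f g) :
    ∃ G : ℝ → ℝ, f =ᵐ[volume.restrict (Ioo a b)] G ∧ IsPrimitiveOn (Ioo a b) G g := by
  obtain ⟨c, hc⟩ := nonempty_Ioo.2 hab
  have hP := isPrimitiveOn_intervalIntegral hc h.2.1
  set P : ℝ → ℝ := fun x => ∫ t in c..x, g t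
  obtain ⟨d, hd⟩ := ae_eq_const_of_integral_mul_deriv_eq_zero hab (h := f - P)
    (h.1.sub hP.isWeakDeriv.1) (fun φ h1 h2 h3 => by
      have e1 := h.2.2 φ h1 h2 h3
      have e2 := hP.isWeakDeriv.2.2 φ h1 h2 h3
      have int : ∀ k : ℝ → ℝ, LocallyIntegrableOn k (Ioo a b) →
          IntegrableOn (fun x => k x * deriv φ x) (Ioo a b) := by
        intro k hk
        have h4 : IntegrableOn k (tsupport φ) := hk.integrableOn_compact_subset h3 h2
        have h5 : IntegrableOn (fun x => k x * deriv φ x) (tsupport φ) :=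
          h4.mul_continuousOn (h1.continuous_deriv (by simp)).continuousOn h2
        exact ((integrableOn_iff_integrable_of_support_subset (by
          intro x hx
          apply tsupport_deriv_subset
          apply subset_tsupport
          intro h0
          exact hx (by simp [h0]))).1 h5).integrableOn
      have e3 : ∫ r in Ioo a b, (f - P) r * deriv φ r
          = ∫ r in Ioo a b, (f r * deriv φ r - P r * deriv φ r) := by
        refine integral_congr_ae (Eventually.of_forall fun x => ?_)
        simp only [Pi.sub_apply]; ring
      rw [e3, integral_sub (int f h.1) (int P hP.isWeakDeriv.1), e1, e2, sub_self])
  refine ⟨fun x => P x + d, ?_, fun x hx y hy => ⟨(hP x hx y hy).1, ?_⟩⟩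
  · filter_upwards [hd] with x hx
    simp only [Pi.sub_apply] at hx
    linarith
  · rw [(hP x hx y hy).2]; ring

/-- Integrability of the derivative up to the end points gives boundary limits. This lets the
existence of a flux limit be deduced before its value is known. -/
theorem IsPrimitiveOn.exists_tendsto {a b : ℝ} (hab : a < b) {G g : ℝ → ℝ}
    (h : IsPrimitiveOn (Ioo a b) G g) (hg : IntegrableOn g (Ioo a b)) :
    ∃ L : ℝ, Tendsto G (𝓝[>] a) (𝓝 L) ∧ Tendsto G (𝓝[<] b) (𝓝 (L + ∫ t in Ioo a b, g t)) := by
  have hgI : IntegrableOn g (uIcc a b) := by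
    rw [uIcc_of_le hab.le]; exact (integrableOn_Icc_iff_integrableOn_Ioo (by simp) (by simp)).2 hg
  have hgi : IntervalIntegrable g volume a b := (intervalIntegrable_iff' (by simp)).2 hgI
  have hc := intervalIntegral.continuousOn_primitive_interval hgI
  rw [uIcc_of_le hab.le] at hc
  obtain ⟨c, hcI⟩ := nonempty_Ioo.2 hab
  have sub : ∀ x ∈ Ioo a b, IntervalIntegrable g volume a x := fun x hx =>
    hgi.mono_set (by rw [uIcc_of_le hab.le, uIcc_of_le hx.1.le]; exact Icc_subset_Icc_right hx.2.le)
  have e : ∀ x ∈ Ioo a b, (G c - ∫ t in a..c, g t) + (∫ t in a..x, g t) = G x := by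
    intro x hx
    have h1 := (h c hcI x hx).2
    have h2 := intervalIntegral.integral_interval_sub_left (sub x hx) (sub c hcI)
    linarith
  refine ⟨G c - ∫ t in a..c, g t, ?_, ?_⟩
  · have h1 : Tendsto (fun x => ∫ t in a..x, g t) (𝓝[>] a) (𝓝 (∫ t in a..a, g t)) :=
      (hc a (left_mem_Icc.2 hab.le)).mono_left (by
        rw [← nhdsWithin_Ioo_eq_nhdsGT hab]; exact nhdsWithin_mono _ Ioo_subset_Icc_self)
    have h2 := h1.const_add (G c - ∫ t in a..c, g t)
    rw [intervalIntegral.integral_same, add_zero] at h2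
    refine h2.congr' ?_
    filter_upwards [Ioo_mem_nhdsGT hab] with x hx using e x hx
  · have h1 : Tendsto (fun x => ∫ t in a..x, g t) (𝓝[<] b) (𝓝 (∫ t in a..b, g t)) :=
      (hc b (right_mem_Icc.2 hab.le)).mono_left (by
        rw [← nhdsWithin_Ioo_eq_nhdsLT hab]; exact nhdsWithin_mono _ Ioo_subset_Icc_self)
    have h2 := h1.const_add (G c - ∫ t in a..c, g t)
    rw [intervalIntegral.integral_of_le hab.le, integral_Ioc_eq_integral_Ioo] at h2
    refine h2.congr' ?_
    filter_upwards [Ioo_mem_nhdsLT hab] with x hx using e x hx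

theorem IsPrimitiveOn.setIntegral_eq_zero {a b : ℝ} (hab : a < b) {G g : ℝ → ℝ}
    (h : IsPrimitiveOn (Ioo a b) G g) (hg : IntegrableOn g (Ioo a b))
    (ha : Tendsto G (𝓝[>] a) (𝓝 0)) (hb : Tendsto G (𝓝[<] b) (𝓝 0)) :
    ∫ t in Ioo a b, g t = 0 := by
  obtain ⟨L, h1, h2⟩ := h.exists_tendsto hab hg
  have e1 := tendsto_nhds_unique h1 ha
  have e2 := tendsto_nhds_unique h2 hb
  linarith

/-! ### Mode intervals, the Barenblatt profile and the weights. -/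

/-- The left end point of `modeInterval N`. -/
noncomputable def modeLeft (N : ℕ) : ℝ := if N = 1 then -1 else 0

theorem modeInterval_eq (N : ℕ) : modeInterval N = Ioo (modeLeft N) 1 := by
  unfold modeInterval modeLeft; split_ifs <;> rfl

theorem modeLeft_lt (N : ℕ) : modeLeft N < 1 := by
  unfold modeLeft; split_ifs <;> norm_num

theorem neg_one_le_modeLeft (N : ℕ) : -1 ≤ modeLeft N := by
  unfold modeLeft; split_ifs <;> norm_num

theorem modeInterval_subset (N : ℕ) : modeInterval N ⊆ Ioo (-1) 1 := by
  rw [modeInterval_eq]; exact Ioo_subset_Ioo_left (neg_one_le_modeLeft N)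

theorem subset_modeInterval (N : ℕ) : Ioo 0 1 ⊆ modeInterval N := by
  rw [modeInterval_eq]; apply Ioo_subset_Ioo_left; unfold modeLeft; split_ifs <;> norm_num

theorem isOpen_modeInterval (N : ℕ) : IsOpen (modeInterval N) := by
  rw [modeInterval_eq]; exact isOpen_Ioo

theorem measurableSet_modeInterval (N : ℕ) : MeasurableSet (modeInterval N) :=
  (isOpen_modeInterval N).measurableSet

theorem one_sub_sq_pos {r : ℝ} (hr : r ∈ Ioo (-1 : ℝ) 1) : 0 < 1 - r ^ 2 := by
  nlinarith [hr.1, hr.2]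

theorem one_sub_sq_pos_of_mem {N : ℕ} {r : ℝ} (hr : r ∈ modeInterval N) : 0 < 1 - r ^ 2 :=
  one_sub_sq_pos (modeInterval_subset N hr)

/-- For `N = 1` the origin is interior to the interval, where division by `r` takes its default
value; pointwise identities are used only off it. -/
theorem ae_ne_zero_modeInterval (N : ℕ) :
    ∀ᵐ r ∂volume.restrict (modeInterval N), r ∈ modeInterval N ∧ r ≠ 0 := by
  refine (ae_restrict_iff' (measurableSet_modeInterval N)).2 ?_
  filter_upwards [Measure.ae_ne volume (0 : ℝ)] with r h0 hr using ⟨hr, h0⟩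

/-- The weight `(1 - r²)^(1/(m-1) - 1) r^(N-1)`, a multiple of `ρ_*^(2-m) r^(N-1)`. -/
noncomputable def modeWeight (N : ℕ) (m r : ℝ) : ℝ := (1 - r ^ 2) ^ (1 / (m - 1) - 1) * r ^ (N - 1)

/-- The constant in `ρ_* = barenblattConst * (1 - r²)^(1/(m-1))`. -/
noncomputable def barenblattConst (m : ℝ) : ℝ := ((m - 1) / (2 * m)) ^ (1 / (m - 1))

theorem barenblattConst_pos {m : ℝ} (hm : 1 < m) : 0 < barenblattConst m :=
  Real.rpow_pos_of_pos (div_pos (by linarith) (by linarith)) _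

theorem barenblatt_eq {m r : ℝ} (hm : 1 < m) (hr : r ∈ Ioo (-1 : ℝ) 1) :
    barenblatt m r = barenblattConst m * (1 - r ^ 2) ^ (1 / (m - 1)) := by
  have h := one_sub_sq_pos hr
  rw [barenblatt, max_eq_left h.le, Real.mul_rpow (div_nonneg (by linarith) (by linarith)) h.le]
  rfl

theorem continuous_barenblatt {m : ℝ} (hm : 1 < m) : Continuous (barenblatt m) := by
  unfold barenblatt
  exact Continuous.rpow_const (by fun_prop) fun r => Or.inr (div_pos one_pos (by linarith)).le

theorem barenblatt_nonneg {m : ℝ} (hm : 1 < m) (r : ℝ) : 0 ≤ barenblatt m r :=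
  Real.rpow_nonneg (mul_nonneg (div_nonneg (by linarith) (by linarith)) (le_max_right _ _)) _

theorem barenblatt_neg (m r : ℝ) : barenblatt m (-r) = barenblatt m r := by
  simp [barenblatt]

theorem sphericalEigenvalue_nonneg {N ℓ : ℕ} (hN : 1 ≤ N) (hℓ : N = 1 → ℓ ≤ 1) :
    0 ≤ sphericalEigenvalue N ℓ := by
  unfold sphericalEigenvalue
  rcases eq_or_lt_of_le hN with h | h
  · have := hℓ h.symm
    subst h
    interval_cases ℓ <;> norm_num
  · have h2 : (2 : ℝ) ≤ N := by exact_mod_cast h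
    have h3 : (0 : ℝ) ≤ ℓ := Nat.cast_nonneg _
    exact mul_nonneg h3 (by linarith)

/-- The singular term `μ_ℓ/r²` is thus present only on `(0,1)`, and there a mode polynomial carries
at least one factor `r`. -/
theorem sphericalEigenvalue_ne_zero {N ℓ : ℕ} (hN : 1 ≤ N) (hℓ : N = 1 → ℓ ≤ 1)
    (h : sphericalEigenvalue N ℓ ≠ 0) : 2 ≤ N ∧ 1 ≤ ℓ := by
  have h1 : ℓ ≠ 0 := by rintro rfl; simp [sphericalEigenvalue] at h
  refine ⟨?_, Nat.one_le_iff_ne_zero.2 h1⟩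
  by_contra hlt
  have h2 : N = 1 := by omega
  have h3 : ℓ = 1 := by have := hℓ h2; omega
  subst h2; subst h3
  norm_num [sphericalEigenvalue] at h

/-- For negative `γ` use `1 - r² ≥ 1 - |r|`, so that a power singular at a single end point
dominates on each half. -/
theorem integrableOn_one_sub_sq_rpow {γ : ℝ} (hγ : -1 < γ) :
    IntegrableOn (fun r : ℝ => (1 - r ^ 2) ^ γ) (Ioo (-1) 1) := by
  have hcont : ContinuousOn (fun r : ℝ => (1 - r ^ 2) ^ γ) (Ioo (-1) 1) :=
    ContinuousOn.rpow_const (by fun_prop) fun r hr => Or.inl (one_sub_sq_pos hr).ne'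
  have hmeas := hcont.aestronglyMeasurable (μ := volume) measurableSet_Ioo
  have hI : ∀ γ' : ℝ, -1 < γ' →
      IntegrableOn (fun r : ℝ => (1 - r) ^ γ' + (1 + r) ^ γ') (Ioo (-1) 1) := by
    intro γ' h
    have h1 : IntervalIntegrable (fun r : ℝ => (1 - r) ^ γ') volume (-1) 1 := by
      have := (intervalIntegral.intervalIntegrable_rpow' (a := 0) (b := 2) h).comp_sub_left 1
      norm_num at this
      exact this.symm
    have h2 : IntervalIntegrable (fun r : ℝ => (1 + r) ^ γ') volume (-1) 1 := by
      have := (intervalIntegral.intervalIntegrable_rpow' (a := 0) (b := 2) h).comp_add_left 1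
      norm_num at this
      exact this
    exact ((intervalIntegrable_iff_integrableOn_Ioo_of_le (by norm_num)).1 (h1.add h2))
  rcases le_or_gt 0 γ with h | h
  · refine Integrable.mono' (integrableOn_const (C := (1 : ℝ)) (by simp)) hmeas ?_
    refine (ae_restrict_iff' measurableSet_Ioo).2 (Eventually.of_forall fun r hr => ?_)
    have := one_sub_sq_pos hr
    rw [Real.norm_of_nonneg (Real.rpow_nonneg this.le _)]
    exact Real.rpow_le_one this.le (by nlinarith) h
  · refine Integrable.mono' (hI γ hγ) hmeas ?_
    refine (ae_restrict_iff' measurableSet_Ioo).2 (Eventually.of_forall fun r hr => ?_)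
    have := one_sub_sq_pos hr
    rw [Real.norm_of_nonneg (Real.rpow_nonneg this.le _)]
    have e1 : 0 < 1 - r := by linarith [hr.2]
    have e2 : 0 < 1 + r := by linarith [hr.1]
    have p1 := Real.rpow_nonneg e1.le γ
    have p2 := Real.rpow_nonneg e2.le γ
    rcases le_or_gt 0 r with h0 | h0
    · have := Real.rpow_le_rpow_of_nonpos e1 (by nlinarith : 1 - r ≤ 1 - r ^ 2) h.le
      linarith
    · have := Real.rpow_le_rpow_of_nonpos e2 (by nlinarith : 1 + r ≤ 1 - r ^ 2) h.le
      linarith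

/-! ### Tame functions: integrability and vanishing fluxes. -/

/-- A growth bound for mode functions that is weaker at `r = 1` than `G = O(1/ρ_*)`. -/
def IsTame (N : ℕ) (m : ℝ) (G : ℝ → ℝ) : Prop :=
  ∃ β K : ℝ, 0 ≤ β ∧ β < 1 / (m - 1) ∧
    ∀ r ∈ modeInterval N, |r| ^ (((N : ℝ) - 1) / 2) * (1 - r ^ 2) ^ β * |G r| ≤ K

theorem abs_pow_eq_rpow_mul {N : ℕ} (hN : 1 ≤ N) (r : ℝ) :
    |r ^ (N - 1)| = |r| ^ (((N : ℝ) - 1) / 2) * |r| ^ (((N : ℝ) - 1) / 2) := by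
  have h : (0 : ℝ) ≤ ((N : ℝ) - 1) / 2 := by
    have : (1 : ℝ) ≤ N := by exact_mod_cast hN
    linarith
  rw [← Real.rpow_add_of_nonneg (abs_nonneg r) h h, abs_pow, ← Real.rpow_natCast,
    Nat.cast_sub hN]
  congr 1
  push_cast; ring

theorem abs_rpow_le_one {N : ℕ} (hN : 1 ≤ N) {r : ℝ} (hr : r ∈ Ioo (-1 : ℝ) 1) :
    |r| ^ (((N : ℝ) - 1) / 2) ≤ 1 := by
  have h : (0 : ℝ) ≤ ((N : ℝ) - 1) / 2 := by
    have : (1 : ℝ) ≤ N := by exact_mod_cast hN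
    linarith
  exact Real.rpow_le_one (abs_nonneg r) (abs_le.2 ⟨hr.1.le, hr.2.le⟩) h

theorem continuousOn_modeWeight (N : ℕ) (m : ℝ) :
    ContinuousOn (modeWeight N m) (Ioo (-1) 1) :=
  (ContinuousOn.rpow_const (by fun_prop) fun r hr => Or.inl (one_sub_sq_pos hr).ne').mul
    (by fun_prop)

theorem exists_bound_on_unit {q : ℝ → ℝ} (hq : Continuous q) :
    ∃ C, 0 ≤ C ∧ ∀ r ∈ Ioo (-1 : ℝ) 1, |q r| ≤ C := by
  obtain ⟨C, hC⟩ := isCompact_Icc.exists_bound_of_continuousOn (s := Icc (-1 : ℝ) 1) hq.continuousOn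
  exact ⟨C, (norm_nonneg _).trans (hC 0 (by norm_num)), fun r hr => hC r (Ioo_subset_Icc_self hr)⟩

/-- The bound leaves the power `1/(m-1) - 1 - β` of `1 - r²`, which exceeds `-1` since `β <
1/(m-1)`. One of the two factors `|r|^((N-1)/2)` of `|r^(N-1)|` absorbs the growth at `0`. -/
theorem IsTame.integrableOn_modeWeight_mul {N : ℕ} (hN : 1 ≤ N) {m : ℝ} {G q : ℝ → ℝ}
    (hG : IsTame N m G) (hc : ContinuousOn G (modeInterval N)) (hq : Continuous q) :
    IntegrableOn (fun r => modeWeight N m r * (G r * q r)) (modeInterval N) := by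
  obtain ⟨β, K, hβ, hβ', hK⟩ := hG
  obtain ⟨C, hC0, hC⟩ := exists_bound_on_unit hq
  have hi := ((integrableOn_one_sub_sq_rpow (γ := 1 / (m - 1) - 1 - β) (by linarith)).mono_set
    (modeInterval_subset N)).const_mul (K * C)
  refine Integrable.mono' hi ?_ ?_
  · exact (((continuousOn_modeWeight N m).mono (modeInterval_subset N)).mul
      (hc.mul hq.continuousOn)).aestronglyMeasurable (measurableSet_modeInterval N)
  · refine (ae_restrict_iff' (measurableSet_modeInterval N)).2 (Eventually.of_forall fun r hr => ?_)
    have h1 := one_sub_sq_pos_of_mem hr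
    have h2 := hK r hr
    have hrI := modeInterval_subset N hr
    have h3 := abs_rpow_le_one hN hrI
    have h4 := hC r hrI
    have hx : 0 ≤ |r| ^ (((N : ℝ) - 1) / 2) := Real.rpow_nonneg (abs_nonneg r) _
    have hp : 0 < (1 - r ^ 2) ^ (1 / (m - 1) - 1 - β) := Real.rpow_pos_of_pos h1 _
    have e : (1 - r ^ 2) ^ (1 / (m - 1) - 1) = (1 - r ^ 2) ^ (1 / (m - 1) - 1 - β) * (1 - r ^ 2) ^ β := by
      rw [← Real.rpow_add h1]; congr 1; ring
    rw [modeWeight, e, Real.norm_eq_abs, abs_mul, abs_mul, abs_mul, abs_mul, abs_pow_eq_rpow_mul hN,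
      abs_of_pos hp, abs_of_pos (Real.rpow_pos_of_pos h1 β)]
    calc _ = (1 - r ^ 2) ^ (1 / (m - 1) - 1 - β) * |r| ^ (((N : ℝ) - 1) / 2) *
            (|r| ^ (((N : ℝ) - 1) / 2) * (1 - r ^ 2) ^ β * |G r|) * |q r| := by ring
      _ ≤ (1 - r ^ 2) ^ (1 / (m - 1) - 1 - β) * 1 * K * C := by
        have hK0 : 0 ≤ K := le_trans (by positivity) h2
        gcongr
      _ = K * C * (1 - r ^ 2) ^ (1 / (m - 1) - 1 - β) := by ring

theorem continuous_barenblatt_mul_pow (N : ℕ) {m : ℝ} (hm : 1 < m) :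
    Continuous fun r => barenblatt m r * r ^ (N - 1) :=
  (continuous_barenblatt hm).mul (by fun_prop)

/-- After the tame bound is used up, the spare powers `(1 - r²)^(1/(m-1) - β)` and `|r|^((N-1)/2)`
remain. The first vanishes at `±1`, the second at `0` when `N ≥ 2`. -/
theorem IsTame.exists_flux_bound {N : ℕ} (hN : 1 ≤ N) {m : ℝ} (hm : 1 < m) {G : ℝ → ℝ}
    (hG : IsTame N m G) : ∃ E : ℝ → ℝ, Continuous E ∧ E 1 = 0 ∧ E (modeLeft N) = 0 ∧
      ∀ r ∈ modeInterval N, |barenblatt m r * r ^ (N - 1) * G r| ≤ E r := by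
  obtain ⟨β, K, hβ, hβ', hK⟩ := hG
  have hs : (0 : ℝ) ≤ ((N : ℝ) - 1) / 2 := by
    have : (1 : ℝ) ≤ N := by exact_mod_cast hN
    linarith
  refine ⟨fun r => barenblattConst m * K * ((1 - r ^ 2) ^ (1 / (m - 1) - β) *
    |r| ^ (((N : ℝ) - 1) / 2)), ?_, ?_, ?_, ?_⟩
  · exact continuous_const.mul ((Continuous.rpow_const (by fun_prop)
      fun r => Or.inr (by linarith)).mul (Continuous.rpow_const (by fun_prop) fun r => Or.inr hs))
  · simp [Real.zero_rpow (by linarith : 1 / (m - 1) - β ≠ 0), -one_div]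
  · unfold modeLeft
    split_ifs with h
    · simp [Real.zero_rpow (by linarith : 1 / (m - 1) - β ≠ 0), -one_div]
    · have h2 : (2 : ℝ) ≤ N := by exact_mod_cast (show 2 ≤ N by omega)
      simp [Real.zero_rpow (by linarith : ((N : ℝ) - 1) / 2 ≠ 0)]
  · intro r hr
    have h1 := one_sub_sq_pos_of_mem hr
    have h2 := hK r hr
    have hrI := modeInterval_subset N hr
    have hx : 0 ≤ |r| ^ (((N : ℝ) - 1) / 2) := Real.rpow_nonneg (abs_nonneg r) _
    have hp : 0 < (1 - r ^ 2) ^ (1 / (m - 1) - β) := Real.rpow_pos_of_pos h1 _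
    have hb := barenblattConst_pos hm
    have e : (1 - r ^ 2) ^ (1 / (m - 1)) = (1 - r ^ 2) ^ (1 / (m - 1) - β) * (1 - r ^ 2) ^ β := by
      rw [← Real.rpow_add h1]; congr 1; ring
    rw [barenblatt_eq hm hrI, e, abs_mul, abs_mul, abs_mul, abs_mul, abs_pow_eq_rpow_mul hN,
      abs_of_pos hp, abs_of_pos (Real.rpow_pos_of_pos h1 β), abs_of_pos hb]
    calc _ = barenblattConst m * (1 - r ^ 2) ^ (1 / (m - 1) - β) * |r| ^ (((N : ℝ) - 1) / 2) *
            (|r| ^ (((N : ℝ) - 1) / 2) * (1 - r ^ 2) ^ β * |G r|) := by ring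
      _ ≤ barenblattConst m * (1 - r ^ 2) ^ (1 / (m - 1) - β) * |r| ^ (((N : ℝ) - 1) / 2) * K := by
        gcongr
      _ = _ := by ring

theorem eventually_mem_nhdsGT_modeLeft (N : ℕ) : ∀ᶠ r in 𝓝[>] modeLeft N, r ∈ modeInterval N := by
  rw [modeInterval_eq]; exact Ioo_mem_nhdsGT (modeLeft_lt N)

theorem eventually_mem_nhdsLT_one (N : ℕ) : ∀ᶠ r in 𝓝[<] (1 : ℝ), r ∈ modeInterval N := by
  rw [modeInterval_eq]; exact Ioo_mem_nhdsLT (modeLeft_lt N)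

theorem IsTame.tendsto_flux {N : ℕ} (hN : 1 ≤ N) {m : ℝ} (hm : 1 < m) {G q : ℝ → ℝ}
    (hG : IsTame N m G) (hq : Continuous q) :
    Tendsto (fun r => barenblatt m r * r ^ (N - 1) * G r * q r) (𝓝[>] modeLeft N) (𝓝 0) ∧
    Tendsto (fun r => barenblatt m r * r ^ (N - 1) * G r * q r) (𝓝[<] 1) (𝓝 0) := by
  obtain ⟨E, hE, h1, h2, hb⟩ := hG.exists_flux_bound hN hm
  constructor
  · have h3 : Tendsto E (𝓝[>] modeLeft N) (𝓝 0) := by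
      rw [← h2]; exact hE.continuousAt.tendsto.mono_left nhdsWithin_le_nhds
    have h4 : Tendsto (fun r => barenblatt m r * r ^ (N - 1) * G r) (𝓝[>] modeLeft N) (𝓝 0) :=
      squeeze_zero_norm' ((eventually_mem_nhdsGT_modeLeft N).mono hb) h3
    simpa using h4.mul (hq.continuousAt.tendsto.mono_left nhdsWithin_le_nhds)
  · have h3 : Tendsto E (𝓝[<] 1) (𝓝 0) := by
      rw [← h1]; exact hE.continuousAt.tendsto.mono_left nhdsWithin_le_nhds
    have h4 : Tendsto (fun r => barenblatt m r * r ^ (N - 1) * G r) (𝓝[<] 1) (𝓝 0) :=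
      squeeze_zero_norm' ((eventually_mem_nhdsLT_one N).mono hb) h3
    simpa using h4.mul (hq.continuousAt.tendsto.mono_left nhdsWithin_le_nhds)

theorem IsTame.integrableOn_spherical {N ℓ : ℕ} (hN : 1 ≤ N) (hℓ : N = 1 → ℓ ≤ 1) {m : ℝ}
    (hm : 1 < m) {G q : ℝ → ℝ}
    (hG : IsTame N m G) (hc : ContinuousOn G (modeInterval N)) (hq : Continuous q) :
    IntegrableOn (fun r => sphericalEigenvalue N ℓ / r ^ 2 * (barenblatt m r * r ^ (N - 1)) *
      (r ^ ℓ * q r) * G r) (modeInterval N) := by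
  by_cases hμ : sphericalEigenvalue N ℓ = 0
  · simp [hμ]
  obtain ⟨hN2, hℓ1⟩ := sphericalEigenvalue_ne_zero hN hℓ hμ
  have hI : modeInterval N = Ioo 0 1 := by unfold modeInterval; rw [if_neg (by omega)]
  obtain ⟨β, K, hβ, hβ', hK⟩ := hG
  obtain ⟨C, hC0, hC⟩ := exists_bound_on_unit hq
  have hμ0 := sphericalEigenvalue_nonneg hN hℓ
  have hb := barenblattConst_pos hm
  rw [hI] at hc hK ⊢
  have hi : IntegrableOn (fun r : ℝ => r ^ (-(1 / 2) : ℝ)) (Ioo 0 1) :=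
    (intervalIntegrable_iff_integrableOn_Ioo_of_le zero_le_one).1
      (intervalIntegral.intervalIntegrable_rpow' (by norm_num))
  refine Integrable.mono' (hi.const_mul (sphericalEigenvalue N ℓ * barenblattConst m * C * K)) ?_ ?_
  · refine ContinuousOn.aestronglyMeasurable ?_ measurableSet_Ioo
    refine ((ContinuousOn.mul ?_ (continuous_barenblatt_mul_pow N hm).continuousOn).mul
      (by fun_prop)).mul hc
    exact continuousOn_const.div (by fun_prop) fun r hr => pow_ne_zero 2 hr.1.ne'
  · refine (ae_restrict_iff' measurableSet_Ioo).2 (Eventually.of_forall fun r hr => ?_)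
    have hrI : r ∈ Ioo (-1 : ℝ) 1 := ⟨by linarith [hr.1], hr.2⟩
    have h1 := one_sub_sq_pos hrI
    have h2 := hK r hr
    have h4 := hC r hrI
    have hp : 0 < (1 - r ^ 2) ^ (1 / (m - 1) - β) := Real.rpow_pos_of_pos h1 _
    have hp1 : (1 - r ^ 2) ^ (1 / (m - 1) - β) ≤ 1 :=
      Real.rpow_le_one h1.le (by nlinarith [hr.1]) (by linarith)
    have e : (1 - r ^ 2) ^ (1 / (m - 1)) = (1 - r ^ 2) ^ (1 / (m - 1) - β) * (1 - r ^ 2) ^ β := by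
      rw [← Real.rpow_add h1]; congr 1; ring
    have hx : 0 ≤ |r| ^ (((N : ℝ) - 1) / 2) := Real.rpow_nonneg (abs_nonneg r) _
    -- For `N ≥ 2` and `ℓ ≥ 1` the powers of `r` combine to at most `r^(1/2) · r / r²`, which is
    -- integrable at `0`.
    have hr1 : |r| ^ (((N : ℝ) - 1) / 2) * (|r ^ ℓ| / r ^ 2) ≤ r ^ (-(1 / 2) : ℝ) := by
      have h5 : |r ^ ℓ| ≤ r := by
        rw [abs_of_pos (pow_pos hr.1 _)]
        exact pow_le_of_le_one hr.1.le hr.2.le (by omega)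
      have h6 : |r| ^ (((N : ℝ) - 1) / 2) ≤ r ^ (1 / 2 : ℝ) := by
        rw [abs_of_pos hr.1]
        have : (2 : ℝ) ≤ N := by exact_mod_cast hN2
        exact Real.rpow_le_rpow_of_exponent_ge hr.1 hr.2.le (by linarith)
      calc _ ≤ r ^ (1 / 2 : ℝ) * (r / r ^ 2) := by
            have := hr.1
            gcongr
        _ = r ^ (-(1 / 2) : ℝ) := by
            have e1 : r / r ^ 2 = r ^ (-1 : ℝ) := by
              rw [Real.rpow_neg_one]; field_simp [hr.1.ne']
            rw [e1, ← Real.rpow_add hr.1]; norm_num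
    rw [barenblatt_eq hm hrI, e, Real.norm_eq_abs, abs_mul, abs_mul, abs_mul, abs_mul, abs_mul,
      abs_mul, abs_mul, abs_div, abs_of_nonneg hμ0,
      abs_pow_eq_rpow_mul hN, abs_of_nonneg (sq_nonneg r),
      abs_of_pos hp, abs_of_pos (Real.rpow_pos_of_pos h1 β), abs_of_pos hb]
    have hK0 : 0 ≤ K := le_trans (by have := Real.rpow_nonneg h1.le β; positivity) h2
    calc _ = sphericalEigenvalue N ℓ * barenblattConst m * (1 - r ^ 2) ^ (1 / (m - 1) - β) * |q r| *
            (|r| ^ (((N : ℝ) - 1) / 2) * (1 - r ^ 2) ^ β * |G r|) *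
            (|r| ^ (((N : ℝ) - 1) / 2) * (|r ^ ℓ| / r ^ 2)) := by ring
      _ ≤ sphericalEigenvalue N ℓ * barenblattConst m * 1 * C * K * r ^ (-(1 / 2) : ℝ) := by
        have : 0 ≤ (1 - r ^ 2) ^ β := Real.rpow_nonneg h1.le β
        gcongr
      _ = _ := by ring

/-- Integrate `g` from `r` to `1/2`. Up to the constant `M` the weight increases along the way
(`comp`), so it can be moved inside the integral. -/
theorem IsPrimitiveOn.exists_weighted_bound {G g : ℝ → ℝ} (h : IsPrimitiveOn (Ioo 0 1) G g)
    {s β : ℝ} (hs : 0 ≤ s) (hβ : 0 ≤ β)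
    (hi : IntegrableOn (fun r => |r| ^ s * (1 - r ^ 2) ^ β * g r) (Ioo 0 1)) :
    ∃ K, ∀ r ∈ Ioo (0 : ℝ) 1, |r| ^ s * (1 - r ^ 2) ^ β * |G r| ≤ K := by
  set S : ℝ → ℝ := fun r => |r| ^ s * (1 - r ^ 2) ^ β with hS
  set M : ℝ := 2 ^ s * (4 / 3) ^ β with hM
  have hM0 : 0 ≤ M := by positivity
  have half : (1 / 2 : ℝ) ∈ Ioo (0 : ℝ) 1 := by norm_num
  have S0 : ∀ r ∈ Ioo (0 : ℝ) 1, 0 ≤ S r := fun r hr => by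
    have := one_sub_sq_pos (r := r) ⟨by linarith [hr.1], hr.2⟩
    simp only [hS]; positivity
  have S1 : ∀ r ∈ Ioo (0 : ℝ) 1, S r ≤ 1 := fun r hr => by
    have h1 := one_sub_sq_pos (r := r) ⟨by linarith [hr.1], hr.2⟩
    simp only [hS]
    refine mul_le_one₀ (Real.rpow_le_one (abs_nonneg _) (abs_le.2 ⟨by linarith [hr.1], hr.2.le⟩) hs)
      (by positivity) (Real.rpow_le_one h1.le (by nlinarith [hr.1]) hβ)
  have comp : ∀ r ∈ Ioo (0 : ℝ) 1, ∀ t ∈ uIcc r (1 / 2), S r ≤ M * S t := by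
    intro r hr t ht
    have htI : t ∈ Ioo (0 : ℝ) 1 := ordConnected_Ioo.uIcc_subset hr half ht
    have h1 := one_sub_sq_pos (r := r) ⟨by linarith [hr.1], hr.2⟩
    have h2 := one_sub_sq_pos (r := t) ⟨by linarith [htI.1], htI.2⟩
    have hA : |r| ≤ 2 * |t| ∧ 1 - r ^ 2 ≤ 4 / 3 * (1 - t ^ 2) := by
      rw [abs_of_pos hr.1, abs_of_pos htI.1]
      rcases le_total r (1 / 2) with hle | hle
      · rw [uIcc_of_le hle] at ht
        constructor
        · linarith [ht.1, hr.1]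
        · nlinarith [ht.1, hr.1, ht.2]
      · rw [uIcc_of_ge hle] at ht
        constructor
        · linarith [ht.1, hr.2]
        · nlinarith [ht.1, hr.1, ht.2, hr.2]
    have h3 : |r| ^ s ≤ 2 ^ s * |t| ^ s := by
      rw [← Real.mul_rpow (by norm_num) (abs_nonneg t)]
      exact Real.rpow_le_rpow (abs_nonneg r) hA.1 hs
    have h4 : (1 - r ^ 2) ^ β ≤ (4 / 3) ^ β * (1 - t ^ 2) ^ β := by
      rw [← Real.mul_rpow (by norm_num) h2.le]
      exact Real.rpow_le_rpow h1.le hA.2 hβ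
    calc S r ≤ (2 ^ s * |t| ^ s) * ((4 / 3) ^ β * (1 - t ^ 2) ^ β) := by
          simp only [hS]; gcongr
      _ = M * S t := by simp only [hM, hS]; ring
  refine ⟨|G (1 / 2)| + M * ∫ t in Ioo 0 1, |S t * g t|, fun r hr => ?_⟩
  obtain ⟨hgi, hge⟩ := h r hr (1 / 2) half
  have hsub : uIoc r (1 / 2) ⊆ Ioo 0 1 :=
    uIoc_subset_uIcc.trans (ordConnected_Ioo.uIcc_subset hr half)
  have hgi' : IntegrableOn g (uIoc r (1 / 2)) := intervalIntegrable_iff.1 hgi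
  have h5 : |G (1 / 2) - G r| ≤ ∫ t in uIoc r (1 / 2), |g t| := by
    rw [← hge]
    exact intervalIntegral.norm_integral_le_integral_norm_uIoc (f := g) (a := r) (b := 1 / 2)
      (μ := volume)
  have h6 : S r * ∫ t in uIoc r (1 / 2), |g t| ≤ M * ∫ t in Ioo 0 1, |S t * g t| := by
    rw [← integral_const_mul, ← integral_const_mul]
    calc ∫ t in uIoc r (1 / 2), S r * |g t| ≤ ∫ t in uIoc r (1 / 2), M * |S t * g t| := by
          refine setIntegral_mono_on (hgi'.abs.const_mul _) ((hi.mono_set hsub).abs.const_mul _)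
            measurableSet_uIoc fun t ht => ?_
          have := comp r hr t (uIoc_subset_uIcc ht)
          rw [abs_mul, abs_of_nonneg (S0 t (hsub ht)), ← mul_assoc]
          gcongr
      _ ≤ ∫ t in Ioo 0 1, M * |S t * g t| :=
          setIntegral_mono_set (hi.abs.const_mul _) (Eventually.of_forall fun t => by positivity)
            (LE.le.eventuallyLE hsub)
  have h7 : |G r| ≤ |G (1 / 2)| + |G (1 / 2) - G r| := by
    have := abs_sub_abs_le_abs_sub (G r) (G (1 / 2))
    rw [abs_sub_comm] at this; linarith
  calc S r * |G r| ≤ S r * (|G (1 / 2)| + |G (1 / 2) - G r|) := by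
        have := S0 r hr; gcongr
    _ = S r * |G (1 / 2)| + S r * |G (1 / 2) - G r| := by ring
    _ ≤ 1 * |G (1 / 2)| + S r * ∫ t in uIoc r (1 / 2), |g t| := by
        have := S0 r hr; have := S1 r hr; gcongr
    _ ≤ _ := by linarith

theorem isTame_of_bound {N : ℕ} {m β K : ℝ} {G : ℝ → ℝ} (hβ : 0 ≤ β) (hβ' : β < 1 / (m - 1))
    (hpar : N = 1 → ∀ r ∈ modeInterval N, |G (-r)| = |G r|)
    (h : ∀ r ∈ Ioo (0 : ℝ) 1, |r| ^ (((N : ℝ) - 1) / 2) * (1 - r ^ 2) ^ β * |G r| ≤ K) :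
    IsTame N m G := by
  -- The value `|G 0|` covers `r = 0`, which belongs to the interval only for `N = 1`.
  refine ⟨β, max K |G 0|, hβ, hβ', fun r hr => ?_⟩
  rcases lt_trichotomy r 0 with hlt | rfl | hgt
  · have hN : N = 1 := by
      by_contra hne
      unfold modeInterval at hr
      rw [if_neg hne] at hr
      exact absurd hr.1 (not_lt.2 hlt.le)
    have := h (-r) ⟨by linarith, by linarith [(modeInterval_subset N hr).1]⟩
    rw [abs_neg, neg_sq, hpar hN r hr] at this
    exact this.trans (le_max_left _ _)
  · refine le_trans ?_ (le_max_right _ _)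
    have hN : N = 1 := by
      by_contra hne
      unfold modeInterval at hr
      rw [if_neg hne] at hr
      exact absurd hr.1 (lt_irrefl _)
    subst hN
    simp
  · exact (h r ⟨hgt, (modeInterval_subset N hr).2⟩).trans (le_max_left _ _)

/-! ### Polynomial mode functions and the triangular action of the operator. -/

open Polynomial in
/-- The mode function `r^ℓ Q(r²)`. -/
noncomputable def modePoly (ℓ : ℕ) (Q : Polynomial ℝ) : Polynomial ℝ := X ^ ℓ * Q.comp (X ^ 2)

open Polynomial in
/-- The operator on `Q` induced by `H_ℓ` on `r^ℓ Q(r²)`. -/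
noncomputable def modeOp (N ℓ : ℕ) (m : ℝ) (Q : Polynomial ℝ) : Polynomial ℝ :=
  -C ((m - 1) / 2) * (1 - X) * (4 * X * derivative (derivative Q)
    + C (4 * (ℓ + (N : ℝ) / 2)) * derivative Q) + C (ℓ : ℝ) * Q + 2 * X * derivative Q

theorem modePoly_eval (ℓ : ℕ) (Q : Polynomial ℝ) (r : ℝ) :
    (modePoly ℓ Q).eval r = r ^ ℓ * Q.eval (r ^ 2) := by
  simp [modePoly]

theorem modePoly_neg (ℓ : ℕ) (Q : Polynomial ℝ) (r : ℝ) :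
    (modePoly ℓ Q).eval (-r) = (-1) ^ ℓ * (modePoly ℓ Q).eval r := by
  rw [modePoly_eval, modePoly_eval, neg_sq, neg_pow]; ring

-- The Euler operator `r d/dr` preserves functions of the form `r^ℓ Q(r²)`; multiplying by `X`
-- avoids the power `ℓ - 1`.
open Polynomial in
theorem X_mul_derivative_modePoly (ℓ : ℕ) (Q : Polynomial ℝ) :
    X * derivative (modePoly ℓ Q) = modePoly ℓ (C (ℓ : ℝ) * Q + 2 * X * derivative Q) := by
  unfold modePoly
  rw [derivative_mul, derivative_comp, derivative_X_pow, derivative_X_pow]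
  simp only [add_comp, mul_comp, C_comp, X_comp, ofNat_comp]
  have hC : (C (2 : ℝ) : ℝ[X]) = 2 := map_ofNat C 2
  cases ℓ with
  | zero => simp [hC]; ring
  | succ n => simp [hC]; ring

-- Both derivatives are expressed through the Euler operator, applied once and twice. The terms in
-- `Q/r²` cancel because `ℓ(ℓ-1) + (N-1)ℓ = μ_ℓ`.
open Polynomial in
theorem modePoly_modeOp (N ℓ : ℕ) (m : ℝ) (Q : Polynomial ℝ) {r : ℝ} (hr : r ≠ 0) :
    (modePoly ℓ (modeOp N ℓ m Q)).eval r =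
      -((m - 1) / 2) * (1 - r ^ 2) * ((derivative (derivative (modePoly ℓ Q))).eval r
        + ((N : ℝ) - 1) / r * (derivative (modePoly ℓ Q)).eval r
        - sphericalEigenvalue N ℓ / r ^ 2 * (modePoly ℓ Q).eval r)
        + r * (derivative (modePoly ℓ Q)).eval r := by
  have h1 := congrArg (eval r) (X_mul_derivative_modePoly ℓ Q)
  have h2 := congrArg (fun P => eval r (derivative P)) (X_mul_derivative_modePoly ℓ Q)
  have h3 := congrArg (eval r) (X_mul_derivative_modePoly ℓ
    (C (ℓ : ℝ) * Q + 2 * X * derivative Q))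
  simp only [modePoly_eval, derivative_mul, derivative_X, eval_add, eval_mul, eval_X, eval_C,
    eval_one, derivative_add, derivative_C, derivative_ofNat, eval_ofNat, eval_zero] at h1 h2 h3 ⊢
  have e1 : eval r (derivative (modePoly ℓ Q)) = r ^ ℓ *
      (ℓ * eval (r ^ 2) Q + 2 * r ^ 2 * eval (r ^ 2) (derivative Q)) / r := by
    field_simp; linarith
  rw [← h2] at h3
  have e2 : eval r (derivative (derivative (modePoly ℓ Q))) = (r ^ ℓ *
      (ℓ * (ℓ * eval (r ^ 2) Q + 2 * r ^ 2 * eval (r ^ 2) (derivative Q)) +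
        2 * r ^ 2 * (ℓ * eval (r ^ 2) (derivative Q) + 2 * eval (r ^ 2) (derivative Q)
          + 2 * r ^ 2 * eval (r ^ 2) (derivative (derivative Q))))
      - r * eval r (derivative (modePoly ℓ Q))) / r ^ 2 := by
    field_simp; linarith
  rw [e2, e1]
  simp only [modeOp, sphericalEigenvalue, eval_add, eval_mul, eval_neg, eval_C, eval_sub, eval_one,
    eval_X, eval_ofNat]
  field_simp
  ring

theorem modeOp_add (N ℓ : ℕ) (m : ℝ) (P Q : Polynomial ℝ) :
    modeOp N ℓ m (P + Q) = modeOp N ℓ m P + modeOp N ℓ m Q := by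
  simp only [modeOp, Polynomial.derivative_add]; ring

theorem modeOp_C_mul (N ℓ : ℕ) (m c : ℝ) (Q : Polynomial ℝ) :
    modeOp N ℓ m (Polynomial.C c * Q) = Polynomial.C c * modeOp N ℓ m Q := by
  simp only [modeOp, Polynomial.derivative_C_mul]; ring

theorem modeOp_C (N ℓ : ℕ) (m c : ℝ) :
    modeOp N ℓ m (Polynomial.C c) = Polynomial.C (ℓ * c) := by
  simp [modeOp]

theorem modeOp_sum (N ℓ : ℕ) (m : ℝ) (s : Finset ℕ) (Q : ℕ → Polynomial ℝ) :
    modeOp N ℓ m (∑ j ∈ s, Q j) = ∑ j ∈ s, modeOp N ℓ m (Q j) := by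
  classical
  induction s using Finset.induction_on with
  | empty => simp [modeOp]
  | insert a s ha ih => rw [Finset.sum_insert ha, Finset.sum_insert ha, modeOp_add, ih]

-- The diagonal entries are the eigenvalues. For `j = 0` the second coefficient is zero, so the
-- truncated exponent `j - 1` is harmless.
open Polynomial in
theorem modeOp_X_pow (N ℓ : ℕ) (m : ℝ) (j : ℕ) :
    modeOp N ℓ m (X ^ j) = C (radialEigenvalue N ℓ j m) * X ^ j
      - C (2 * (m - 1) * j * (j + ℓ + (N : ℝ) / 2 - 1)) * X ^ (j - 1) := by
  refine Polynomial.funext fun x => ?_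
  simp only [modeOp, radialEigenvalue, derivative_X_pow, derivative_C_mul, eval_add, eval_mul,
    eval_neg, eval_C, eval_sub, eval_one, eval_X, eval_ofNat, eval_pow]
  rcases j with _ | _ | n
  · simp
  · simp; ring
  · simp; ring

open Polynomial in
/-- The coefficients of the terminating hypergeometric series of `radialEigenfunction`. -/
noncomputable def eigenCoeff (N ℓ k : ℕ) (m : ℝ) (j : ℕ) : ℝ :=
  (ascPochhammer ℝ j).eval (-(k : ℝ)) *
    (ascPochhammer ℝ j).eval (1 / (m - 1) + ℓ + (N : ℝ) / 2 - 1 + k)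
      / ((ascPochhammer ℝ j).eval (ℓ + (N : ℝ) / 2) * (j.factorial : ℝ))

open Polynomial in
/-- The polynomial `Q` with `radialEigenfunction N ℓ k m r = r^ℓ Q(r²)`. -/
noncomputable def eigenPoly (N ℓ k : ℕ) (m : ℝ) : Polynomial ℝ :=
  ∑ j ∈ Finset.range (k + 1), C (eigenCoeff N ℓ k m j) * X ^ j

theorem radialEigenfunction_eq (N ℓ k : ℕ) (m r : ℝ) :
    radialEigenfunction N ℓ k m r = (modePoly ℓ (eigenPoly N ℓ k m)).eval r := by
  rw [modePoly_eval, radialEigenfunction, eigenPoly, Polynomial.eval_finsetSum, hypergeometricPoly]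
  simp [eigenCoeff]

open Polynomial in
theorem eigenCoeff_zero (N ℓ k : ℕ) (m : ℝ) : eigenCoeff N ℓ k m 0 = 1 := by
  simp [eigenCoeff]

/-- The ratio of consecutive hypergeometric coefficients, rewritten with the factorisation of
`λ_{ℓj} - λ_{ℓk}` into `j - k` and a factor proportional to `b + j`. This is the coefficient
recursion of the eigenvalue equation. -/
theorem eigenCoeff_succ {N : ℕ} (hN : 1 ≤ N) (ℓ k : ℕ) {m : ℝ} (hm : 1 < m) (j : ℕ) :
    eigenCoeff N ℓ k m (j + 1) * (2 * (m - 1) * (j + 1) * (j + ℓ + (N : ℝ) / 2)) =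
      eigenCoeff N ℓ k m j * (radialEigenvalue N ℓ j m - radialEigenvalue N ℓ k m) := by
  have hN' : (1 : ℝ) ≤ N := by exact_mod_cast hN
  have hℓ : (0 : ℝ) ≤ ℓ := Nat.cast_nonneg _
  have hj : (0 : ℝ) ≤ j := Nat.cast_nonneg _
  have hc : 0 < (ascPochhammer ℝ j).eval (ℓ + (N : ℝ) / 2) := ascPochhammer_pos j _ (by linarith)
  have hf : (0 : ℝ) < j.factorial := by exact_mod_cast j.factorial_pos
  have hm' : m - 1 ≠ 0 := by linarith
  have h1 : (ℓ : ℝ) + (N : ℝ) / 2 + j ≠ 0 := by linarith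
  have h2 : (j : ℝ) + 1 ≠ 0 := by linarith
  unfold eigenCoeff radialEigenvalue
  simp only [ascPochhammer_succ_eval, Nat.factorial_succ]
  push_cast
  field_simp
  ring

open Polynomial in
theorem modeOp_eigenPoly {N : ℕ} (hN : 1 ≤ N) (ℓ k : ℕ) {m : ℝ} (hm : 1 < m) :
    modeOp N ℓ m (eigenPoly N ℓ k m) = C (radialEigenvalue N ℓ k m) * eigenPoly N ℓ k m := by
  unfold eigenPoly
  rw [modeOp_sum]
  simp only [modeOp_C_mul, modeOp_X_pow]
  rw [Finset.sum_congr rfl fun j _ => mul_sub _ _ _, Finset.sum_sub_distrib, Finset.mul_sum]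
  rw [Finset.sum_range_succ' (fun j => C (eigenCoeff N ℓ k m j) *
    (C (2 * (m - 1) * j * (j + ℓ + (N : ℝ) / 2 - 1)) * X ^ (j - 1)))]
  have e : ∀ j : ℕ, C (eigenCoeff N ℓ k m (j + 1)) * (C (2 * (m - 1) * ((j + 1 : ℕ) : ℝ) *
      (((j + 1 : ℕ) : ℝ) + ℓ + (N : ℝ) / 2 - 1)) * X ^ (j + 1 - 1)) =
      C (eigenCoeff N ℓ k m j * (radialEigenvalue N ℓ j m - radialEigenvalue N ℓ k m)) * X ^ j := by
    intro j
    rw [← eigenCoeff_succ hN ℓ k hm j, ← mul_assoc, ← C_mul]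
    push_cast
    congr 2
    ring
  simp only [e]
  -- The summand `j = k` may be added because its factor `λ_{ℓk} - λ_{ℓk}` is zero; this is where
  -- the series terminates.
  have e2 : ∑ j ∈ Finset.range k, C (eigenCoeff N ℓ k m j *
      (radialEigenvalue N ℓ j m - radialEigenvalue N ℓ k m)) * (X : ℝ[X]) ^ j
      = ∑ j ∈ Finset.range (k + 1), C (eigenCoeff N ℓ k m j *
      (radialEigenvalue N ℓ j m - radialEigenvalue N ℓ k m)) * X ^ j := by
    rw [Finset.sum_range_succ]; simp
  rw [e2]
  simp only [Nat.cast_zero, mul_zero, zero_mul, map_zero, add_zero]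
  rw [← Finset.sum_sub_distrib]
  refine Finset.sum_congr rfl fun j _ => ?_
  simp only [map_mul, map_sub]
  ring

open Polynomial in
theorem eigenPoly_eval_zero (N ℓ k : ℕ) (m : ℝ) : (eigenPoly N ℓ k m).eval 0 = 1 := by
  unfold eigenPoly
  rw [eval_finsetSum, Finset.sum_range_succ', Finset.sum_eq_zero]
  · simp [eigenCoeff_zero]
  · simp

theorem radialEigenvalue_sub (N ℓ j k : ℕ) (m : ℝ) :
    radialEigenvalue N ℓ j m - radialEigenvalue N ℓ k m =
      2 * ((j : ℝ) - k) * (1 + (m - 1) * (j + k + ℓ + (N : ℝ) / 2 - 1)) := by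
  unfold radialEigenvalue; ring

/-- In the factorisation of the difference, `j ≠ k` gives `j + k ≥ 1`, so `j + k + ℓ + N/2 - 1 ≥ 0`
and the second factor is positive. -/
theorem radialEigenvalue_injective {N : ℕ} (hN : 1 ≤ N) (ℓ : ℕ) {m : ℝ} (hm : 1 < m) {j k : ℕ}
    (h : radialEigenvalue N ℓ j m = radialEigenvalue N ℓ k m) : j = k := by
  by_contra hne
  have h0 := radialEigenvalue_sub N ℓ j k m
  rw [h, sub_self] at h0
  have hN' : (1 : ℝ) ≤ N := by exact_mod_cast hN
  have hℓ : (0 : ℝ) ≤ ℓ := Nat.cast_nonneg _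
  have hjk : (1 : ℝ) ≤ (j : ℝ) + k := by exact_mod_cast (show 1 ≤ j + k by omega)
  have h1 : 0 < 1 + (m - 1) * (j + k + ℓ + (N : ℝ) / 2 - 1) := by
    have : 0 ≤ (m - 1) * (j + k + ℓ + (N : ℝ) / 2 - 1) :=
      mul_nonneg (by linarith) (by linarith)
    linarith
  have h2 : (j : ℝ) - k ≠ 0 := sub_ne_zero.2 (by exact_mod_cast hne)
  exact (mul_ne_zero (mul_ne_zero two_ne_zero h2) h1.ne') h0.symm

/-! ### Divergence form and integration by parts against mode polynomials. -/

/-- The derivative of `ρ_* r^(N-1)`. -/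
noncomputable def fluxWeightDeriv (N : ℕ) (m r : ℝ) : ℝ :=
  barenblattConst m * ((1 / (m - 1)) * (1 - r ^ 2) ^ (1 / (m - 1) - 1) * (-(2 * r))) * r ^ (N - 1)
    + barenblatt m r * (((N - 1 : ℕ) : ℝ) * r ^ (N - 1 - 1))

theorem hasDerivAt_fluxWeight (N : ℕ) {m r : ℝ} (hm : 1 < m) (hr : r ∈ Ioo (-1 : ℝ) 1) :
    HasDerivAt (fun r => barenblatt m r * r ^ (N - 1)) (fluxWeightDeriv N m r) r := by
  have h1 := one_sub_sq_pos hr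
  have hb : HasDerivAt (barenblatt m)
      (barenblattConst m * ((1 / (m - 1)) * (1 - r ^ 2) ^ (1 / (m - 1) - 1) * (-(2 * r)))) r := by
    have h2 : HasDerivAt (fun r : ℝ => 1 - r ^ 2) (-(2 * r)) r := by
      simpa using (hasDerivAt_pow 2 r).const_sub 1
    have h3 := (h2.rpow_const (p := 1 / (m - 1)) (Or.inl h1.ne')).const_mul (barenblattConst m)
    refine (h3.congr_of_eventuallyEq ?_).congr_deriv (by ring)
    filter_upwards [isOpen_Ioo.mem_nhds hr] with x hx using barenblatt_eq hm hx
  exact hb.mul (hasDerivAt_pow (N - 1) r)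

theorem continuousOn_fluxWeightDeriv (N : ℕ) {m : ℝ} (hm : 1 < m) :
    ContinuousOn (fluxWeightDeriv N m) (Ioo (-1) 1) := by
  unfold fluxWeightDeriv
  have := continuous_barenblatt hm
  refine ContinuousOn.add (ContinuousOn.mul (continuousOn_const.mul (ContinuousOn.mul
    (continuousOn_const.mul (ContinuousOn.rpow_const (by fun_prop)
      fun r hr => Or.inl (one_sub_sq_pos hr).ne')) (by fun_prop))) (by fun_prop)) (by fun_prop)

theorem isPrimitiveOn_fluxWeight (N : ℕ) {m : ℝ} (hm : 1 < m) :
    IsPrimitiveOn (modeInterval N) (fun r => barenblatt m r * r ^ (N - 1)) (fluxWeightDeriv N m) :=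
  (IsPrimitiveOn.of_hasDerivAt ordConnected_Ioo (fun _ hx => hasDerivAt_fluxWeight N hm hx)
    (continuousOn_fluxWeightDeriv N hm)).mono (modeInterval_subset N)

/-- The divergence form of the radial operator, for a function with value `F₀`, first derivative
`F₁` and second derivative `F₂` at `r`. -/
theorem flux_identity {N : ℕ} (hN : 1 ≤ N) (ℓ : ℕ) {m r : ℝ} (hm : 1 < m)
    (hr : r ∈ Ioo (-1 : ℝ) 1) (h0 : r ≠ 0) (F₀ F₁ F₂ : ℝ) :
    fluxWeightDeriv N m r * F₁ + barenblatt m r * r ^ (N - 1) * F₂ =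
      sphericalEigenvalue N ℓ / r ^ 2 * (barenblatt m r * r ^ (N - 1)) * F₀
      - 2 / (m - 1) * barenblattConst m * (modeWeight N m r *
        (-((m - 1) / 2) * (1 - r ^ 2) * (F₂ + ((N : ℝ) - 1) / r * F₁
          - sphericalEigenvalue N ℓ / r ^ 2 * F₀) + r * F₁)) := by
  have h1 := one_sub_sq_pos hr
  have hm' : m - 1 ≠ 0 := by linarith
  have e : (1 - r ^ 2) ^ (1 / (m - 1)) = (1 - r ^ 2) ^ (1 / (m - 1) - 1) * (1 - r ^ 2) := by
    rw [Real.rpow_sub_one h1.ne']; field_simp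
  -- For `N = 1` both sides vanish, whatever the truncated exponent.
  have e2 : ((N - 1 : ℕ) : ℝ) * r ^ (N - 1 - 1) = ((N : ℝ) - 1) / r * r ^ (N - 1) := by
    obtain ⟨n, rfl⟩ : ∃ n, N = n + 1 := ⟨N - 1, by omega⟩
    rcases n with _ | n
    · simp
    · simp [pow_succ]; field_simp
  rw [fluxWeightDeriv, modeWeight, e2, barenblatt_eq hm hr, e]
  generalize (1 - r ^ 2) ^ (1 / (m - 1) - 1) = y
  generalize r ^ (N - 1) = z
  field_simp
  ring

theorem mul_barenblatt_rpow {m r : ℝ} (hm : 1 < m) (hr : r ∈ Ioo (-1 : ℝ) 1) :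
    -m * barenblatt m r ^ (m - 1) = -((m - 1) / 2) * (1 - r ^ 2) := by
  have h1 := one_sub_sq_pos hr
  have hm' : m - 1 ≠ 0 := by linarith
  have hm0 : m ≠ 0 := by linarith
  rw [barenblatt, max_eq_left h1.le, ← Real.rpow_mul (mul_nonneg (div_nonneg (by linarith)
    (by linarith)) h1.le), one_div_mul_cancel hm', Real.rpow_one]
  field_simp

theorem pow_nonneg_of_mem_modeInterval {N : ℕ} (hN : 1 ≤ N) {r : ℝ} (hr : r ∈ modeInterval N) :
    0 ≤ r ^ (N - 1) := by
  rcases eq_or_lt_of_le hN with h | h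
  · simp [← h]
  · unfold modeInterval at hr
    rw [if_neg (by omega)] at hr
    exact pow_nonneg hr.1.le _

theorem neg_mem_modeInterval_one {r : ℝ} (hr : r ∈ modeInterval 1) : -r ∈ modeInterval 1 := by
  simp only [modeInterval, if_true, mem_Ioo] at hr ⊢
  constructor <;> linarith [hr.1, hr.2]

theorem ordConnected_modeInterval (N : ℕ) : (modeInterval N).OrdConnected := by
  rw [modeInterval_eq]; exact ordConnected_Ioo

/-- The divergence form replaces the derivative of the flux of a mode polynomial by a spherical term
and a weighted polynomial, and each of them is integrable against a tame function. -/
theorem integrableOn_flux_derivative {N ℓ : ℕ} (hN : 1 ≤ N) (hℓ : N = 1 → ℓ ≤ 1) {m : ℝ}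
    (hm : 1 < m) {G : ℝ → ℝ} (hG : IsTame N m G) (hc : ContinuousOn G (modeInterval N))
    (Q : Polynomial ℝ) :
    IntegrableOn (fun r => (fluxWeightDeriv N m r * (modePoly ℓ Q).derivative.eval r
      + barenblatt m r * r ^ (N - 1) * (modePoly ℓ Q).derivative.derivative.eval r) * G r)
      (modeInterval N) := by
  have h1 := hG.integrableOn_spherical (ℓ := ℓ) hN hℓ hm hc (q := fun r => Q.eval (r ^ 2))
    (by fun_prop)
  have h2 := hG.integrableOn_modeWeight_mul hN hc
    (q := fun r => (modePoly ℓ (modeOp N ℓ m Q)).eval r) (by fun_prop)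
  refine (h1.sub (h2.const_mul (2 / (m - 1) * barenblattConst m))).congr_fun_ae ?_
  filter_upwards [ae_ne_zero_modeInterval N] with r ⟨hr, h0⟩
  rw [flux_identity hN ℓ hm (modeInterval_subset N hr) h0 ((modePoly ℓ Q).eval r),
    ← modePoly_modeOp N ℓ m Q h0]
  simp only [Pi.sub_apply, modePoly_eval]
  ring

/-- The integral of the derivative of `ρ_* r^(N-1) p' G` vanishes, because tameness makes this
product tend to zero at both ends. This serves both to verify the boundary condition for mode
polynomials and to move derivatives onto them. -/
theorem integral_flux_modePoly {N ℓ : ℕ} (hN : 1 ≤ N) (hℓ : N = 1 → ℓ ≤ 1) {m : ℝ} (hm : 1 < m)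
    {G g : ℝ → ℝ} (hp : IsPrimitiveOn (modeInterval N) G g) (hG : IsTame N m G)
    (hg : IntegrableOn (fun r => barenblatt m r * r ^ (N - 1) * g r ^ 2) (modeInterval N))
    (Q : Polynomial ℝ) :
    IntegrableOn (fun r => barenblatt m r * r ^ (N - 1) * (modePoly ℓ Q).derivative.eval r * g r)
      (modeInterval N) ∧
    IntegrableOn (fun r => (fluxWeightDeriv N m r * (modePoly ℓ Q).derivative.eval r
      + barenblatt m r * r ^ (N - 1) * (modePoly ℓ Q).derivative.derivative.eval r) * G r)
      (modeInterval N) ∧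
    ∫ r in modeInterval N, barenblatt m r * r ^ (N - 1) * (modePoly ℓ Q).derivative.eval r * g r
      = - ∫ r in modeInterval N, (fluxWeightDeriv N m r * (modePoly ℓ Q).derivative.eval r
      + barenblatt m r * r ^ (N - 1) * (modePoly ℓ Q).derivative.derivative.eval r) * G r := by
  have hp' : IsPrimitiveOn (Ioo (modeLeft N) 1) G g := modeInterval_eq N ▸ hp
  have hc : ContinuousOn G (modeInterval N) := modeInterval_eq N ▸ hp'.continuousOn
  have gmeas : AEStronglyMeasurable g (volume.restrict (modeInterval N)) := by
    rw [modeInterval_eq]; exact hp'.locallyIntegrableOn.aestronglyMeasurable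
  have h1 : IntegrableOn (fun r => barenblatt m r * r ^ (N - 1) *
      (modePoly ℓ Q).derivative.eval r * g r) (modeInterval N) := by
    obtain ⟨C, hC0, hC⟩ := exists_bound_on_unit (q := fun r => barenblatt m r * r ^ (N - 1) *
      (modePoly ℓ Q).derivative.eval r ^ 2)
      ((continuous_barenblatt_mul_pow N hm).mul (by fun_prop))
    refine Integrable.mono' (hg.add (integrableOn_const (C := C) ?_)) ?_ ?_
    · rw [modeInterval_eq]; simp
    · exact (((continuous_barenblatt_mul_pow N hm).mul
        (by fun_prop)).aestronglyMeasurable).mul gmeas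
    · refine (ae_restrict_iff' (measurableSet_modeInterval N)).2
        (Eventually.of_forall fun r hr => ?_)
      have h2 := (le_abs_self _).trans (hC r (modeInterval_subset N hr))
      have hW : 0 ≤ barenblatt m r * r ^ (N - 1) :=
        mul_nonneg (barenblatt_nonneg hm r) (pow_nonneg_of_mem_modeInterval hN hr)
      rw [Real.norm_eq_abs, mul_assoc, abs_mul, abs_of_nonneg hW]
      -- Young's inequality reduces the mixed term to the energy of `G` and a bounded function.
      have h3 : |(modePoly ℓ Q).derivative.eval r * g r| ≤
          g r ^ 2 + (modePoly ℓ Q).derivative.eval r ^ 2 := by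
        rw [abs_le]; constructor <;> nlinarith [sq_nonneg ((modePoly ℓ Q).derivative.eval r + g r),
          sq_nonneg ((modePoly ℓ Q).derivative.eval r - g r), sq_nonneg (g r),
          sq_nonneg ((modePoly ℓ Q).derivative.eval r)]
      calc _ ≤ barenblatt m r * r ^ (N - 1) *
            (g r ^ 2 + (modePoly ℓ Q).derivative.eval r ^ 2) := by gcongr
        _ = barenblatt m r * r ^ (N - 1) * g r ^ 2 +
            barenblatt m r * r ^ (N - 1) * (modePoly ℓ Q).derivative.eval r ^ 2 := by ring
        _ ≤ _ := by
            simp only [Pi.add_apply]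
            linarith
  have h2 := integrableOn_flux_derivative hN hℓ hm hG hc Q
  refine ⟨h1, h2, ?_⟩
  have hpp : IsPrimitiveOn (modeInterval N) (fun r => (modePoly ℓ Q).derivative.eval r)
      (fun r => (modePoly ℓ Q).derivative.derivative.eval r) :=
    IsPrimitiveOn.of_hasDerivAt (ordConnected_modeInterval N)
      (fun x _ => (modePoly ℓ Q).derivative.hasDerivAt x) (by fun_prop)
  have hΦ := ((isPrimitiveOn_fluxWeight N hm).mul (ordConnected_modeInterval N) hpp).mul
    (ordConnected_modeInterval N) hp
  have ht := hG.tendsto_flux hN hm (q := fun r => (modePoly ℓ Q).derivative.eval r) (by fun_prop)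
  rw [modeInterval_eq] at hΦ
  have h3 := h2.add h1
  have h0 := hΦ.setIntegral_eq_zero (modeLeft_lt N) (modeInterval_eq N ▸ h3)
    (ht.1.congr fun r => by ring) (ht.2.congr fun r => by ring)
  rw [← modeInterval_eq] at h0
  rw [integral_add h2 h1] at h0
  linarith

/-! ### Continuous representatives of elements of `H¹_ℓ`. -/

theorem ae_comp_neg_modeInterval_one {p : ℝ → Prop}
    (h : ∀ᵐ r ∂volume.restrict (modeInterval 1), p r) :
    ∀ᵐ r ∂volume.restrict (modeInterval 1), p (-r) := by
  rw [ae_restrict_iff' (measurableSet_modeInterval 1)] at h ⊢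
  filter_upwards [(Measure.measurePreserving_neg (volume : Measure ℝ)).quasiMeasurePreserving.ae h]
    with r hr h1 using hr (neg_mem_modeInterval_one h1)

theorem hasModeParity_pointwise {N ℓ : ℕ} {f G : ℝ → ℝ} (hf : HasModeParity N ℓ f)
    (hG : f =ᵐ[volume.restrict (modeInterval N)] G) (hc : ContinuousOn G (modeInterval N)) :
    N = 1 → ∀ r ∈ modeInterval N, G (-r) = (-1) ^ ℓ * G r := by
  rintro rfl
  have h1 := hf rfl
  have h2 := ae_comp_neg_modeInterval_one hG
  refine Measure.eqOn_open_of_ae_eq (μ := volume) ?_ (isOpen_modeInterval 1) ?_ ?_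
  · filter_upwards [h1, h2, hG] with r e1 e2 e3
    rw [← e2, e1, e3]
  · exact hc.comp continuous_neg.continuousOn fun r hr => neg_mem_modeInterval_one hr
  · exact continuousOn_const.mul hc

theorem hasModeParity_of_pointwise {N ℓ : ℕ} {f G : ℝ → ℝ}
    (hG : f =ᵐ[volume.restrict (modeInterval N)] G)
    (h : N = 1 → ∀ r ∈ modeInterval N, G (-r) = (-1) ^ ℓ * G r) : HasModeParity N ℓ f := by
  rintro rfl
  filter_upwards [ae_comp_neg_modeInterval_one hG, hG,
    ae_restrict_mem (measurableSet_modeInterval 1)] with r e1 e2 e3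
  rw [e1, e2, h rfl r e3]

theorem abs_neg_one_pow_mul (ℓ : ℕ) (x : ℝ) : |(-1) ^ ℓ * x| = |x| := by
  rw [abs_mul, abs_pow, abs_neg, abs_one, one_pow, one_mul]

/-- Finite energy puts `r^((N-1)/2) (1 - r²)^(1/(2(m-1))) g'` in `L²(0,1)`, hence in `L¹`, and
integrating yields tameness with half the critical exponent. Parity carries the bound to `(-1,0)`
for `N = 1`. -/
theorem MemModeSpace.exists_representative {N ℓ : ℕ} (hN : 1 ≤ N) (hℓ : N = 1 → ℓ ≤ 1) {m : ℝ}
    (hm : 1 < m) {g : ℝ → ℝ} (hg : MemModeSpace N ℓ m g) :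
    ∃ G : ℝ → ℝ, g =ᵐ[volume.restrict (modeInterval N)] G ∧
      IsPrimitiveOn (modeInterval N) G (weakDeriv (modeInterval N) g) ∧ IsTame N m G ∧
      ContinuousOn G (modeInterval N) ∧
      IntegrableOn (fun r => barenblatt m r * r ^ (N - 1) * weakDeriv (modeInterval N) g r ^ 2)
        (modeInterval N) ∧
      (N = 1 → ∀ r ∈ modeInterval N, G (-r) = (-1) ^ ℓ * G r) := by
  obtain ⟨⟨_, g', hg', _⟩, hpar, hen⟩ := hg
  have hs := weakDeriv_spec hg'
  set d := weakDeriv (modeInterval N) g with hd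
  have hs' : IsWeakDeriv (Ioo (modeLeft N) 1) g d := modeInterval_eq N ▸ hs
  obtain ⟨G, hG, hGp⟩ := hs'.exists_isPrimitiveOn (modeLeft_lt N)
  have hc := hGp.continuousOn
  have dmeas : AEStronglyMeasurable d (volume.restrict (modeInterval N)) := by
    rw [modeInterval_eq]; exact hGp.locallyIntegrableOn.aestronglyMeasurable
  rw [← modeInterval_eq] at hG hGp hc
  have hμ := sphericalEigenvalue_nonneg hN hℓ
  have h1 : IntegrableOn (fun r => barenblatt m r * r ^ (N - 1) * d r ^ 2) (modeInterval N) := by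
    refine Integrable.mono' hen (((continuous_barenblatt_mul_pow N hm).aestronglyMeasurable).mul
      (dmeas.pow 2)) ((ae_restrict_iff' (measurableSet_modeInterval N)).2
        (Eventually.of_forall fun r hr => ?_))
    have hW : 0 ≤ barenblatt m r * r ^ (N - 1) :=
      mul_nonneg (barenblatt_nonneg hm r) (pow_nonneg_of_mem_modeInterval hN hr)
    have e : modeEnergyDensity N ℓ m g d r = barenblatt m r * r ^ (N - 1) *
        (d r ^ 2 + sphericalEigenvalue N ℓ / r ^ 2 * g r ^ 2) := by
      unfold modeEnergyDensity; ring
    rw [Real.norm_of_nonneg (mul_nonneg hW (sq_nonneg _)), e]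
    have : 0 ≤ sphericalEigenvalue N ℓ / r ^ 2 * g r ^ 2 := by positivity
    exact mul_le_mul_of_nonneg_left (by linarith) hW
  have hparG := hasModeParity_pointwise hpar hG hc
  refine ⟨G, hG, hGp, ?_, hc, h1, hparG⟩
  have hα : 0 < 1 / (m - 1) := div_pos one_pos (by linarith)
  have hb := barenblattConst_pos hm
  have hs0 : (0 : ℝ) ≤ ((N : ℝ) - 1) / 2 := by
    have : (1 : ℝ) ≤ N := by exact_mod_cast hN
    linarith
  have hsub := subset_modeInterval N
  obtain ⟨K, hK⟩ := (hGp.mono hsub).exists_weighted_bound hs0 (β := 1 / (m - 1) / 2) (by linarith) (by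
    refine Integrable.mono' (((h1.mono_set hsub).const_mul (barenblattConst m)⁻¹).add
      (integrableOn_const (C := (1 : ℝ)) (by simp))) ?_ ?_
    · refine AEStronglyMeasurable.mul (Continuous.aestronglyMeasurable ?_)
        (dmeas.mono_measure (Measure.restrict_mono hsub le_rfl))
      exact (Continuous.rpow_const (by fun_prop) fun r => Or.inr hs0).mul
        (Continuous.rpow_const (by fun_prop) fun r => Or.inr (by linarith))
    · refine (ae_restrict_iff' measurableSet_Ioo).2 (Eventually.of_forall fun r hr => ?_)
      have hrI : r ∈ Ioo (-1 : ℝ) 1 := ⟨by linarith [hr.1], hr.2⟩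
      have h2 := one_sub_sq_pos hrI
      set S := |r| ^ (((N : ℝ) - 1) / 2) * (1 - r ^ 2) ^ (1 / (m - 1) / 2) with hS
      have e : barenblatt m r * r ^ (N - 1) = barenblattConst m * S ^ 2 := by
        rw [barenblatt_eq hm hrI, ← abs_of_nonneg (pow_nonneg hr.1.le (N - 1)),
          abs_pow_eq_rpow_mul hN, hS, mul_pow, ← Real.rpow_natCast ((1 - r ^ 2) ^ _) 2,
          ← Real.rpow_mul h2.le]
        have : 1 / (m - 1) / 2 * ((2 : ℕ) : ℝ) = 1 / (m - 1) := by push_cast; ring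
        rw [this]; ring
      simp only [Pi.add_apply]
      rw [e, Real.norm_eq_abs]
      have e3 : (barenblattConst m)⁻¹ * (barenblattConst m * S ^ 2 * d r ^ 2) = (S * d r) ^ 2 := by
        field_simp
      -- The embedding of `L²` into `L¹` takes the pointwise form `|x| ≤ x² + 1`.
      rw [e3, abs_le]
      constructor <;> nlinarith [sq_nonneg (S * d r + 1), sq_nonneg (S * d r - 1)])
  exact isTame_of_bound (by linarith) (by linarith)
    (fun h r hr => by rw [hparG h r hr, abs_neg_one_pow_mul]) hK

/-! ### Mode polynomials lie in the operator domain. -/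

theorem isWeakDeriv_flux {N : ℕ} {m : ℝ} (hm : 1 < m) {f₁ f₂ : ℝ → ℝ}
    (h : IsWeakDeriv (modeInterval N) f₁ f₂) :
    IsWeakDeriv (modeInterval N) (fun r => barenblatt m r * f₁ r * r ^ (N - 1))
      (fun r => fluxWeightDeriv N m r * f₁ r + barenblatt m r * r ^ (N - 1) * f₂ r) := by
  rw [modeInterval_eq] at h ⊢
  obtain ⟨D, hD, hDp⟩ := h.exists_isPrimitiveOn (modeLeft_lt N)
  have hW := isPrimitiveOn_fluxWeight N hm
  rw [modeInterval_eq] at hW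
  refine (hW.mul ordConnected_Ioo hDp).isWeakDeriv.congr_ae ?_ ?_
  · filter_upwards [hD] with r hr
    rw [← hr]; ring
  · filter_upwards [hD] with r hr
    rw [← hr]

theorem weakDeriv_modeInterval_ae_eq {N : ℕ} {f g : ℝ → ℝ} (h : IsWeakDeriv (modeInterval N) f g) :
    weakDeriv (modeInterval N) f =ᵐ[volume.restrict (modeInterval N)] g := by
  rw [modeInterval_eq] at h ⊢
  exact weakDeriv_ae_eq h

theorem contDiff_polynomial_eval (P : Polynomial ℝ) : ContDiff ℝ ∞ fun r => P.eval r := by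
  simpa using P.contDiff_aeval (𝕜 := ℝ) ∞

theorem modePoly_contDiff (ℓ : ℕ) (Q : Polynomial ℝ) :
    ContDiff ℝ ∞ fun r => (modePoly ℓ Q).eval r := contDiff_polynomial_eval _

section Smooth

variable {N ℓ : ℕ} {m : ℝ} {f : ℝ → ℝ} {Q : Polynomial ℝ}

theorem weakDeriv_of_ae_eq_modePoly
    (hf : f =ᵐ[volume.restrict (modeInterval N)] fun r => (modePoly ℓ Q).eval r) :
    weakDeriv (modeInterval N) f =ᵐ[volume.restrict (modeInterval N)]
      fun r => (modePoly ℓ Q).derivative.eval r := by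
  rw [modeInterval_eq] at hf ⊢
  rw [weakDeriv_congr_ae hf]
  have := weakDeriv_ae_eq (isWeakDeriv_deriv (modePoly_contDiff ℓ Q) (modeLeft N) 1)
  filter_upwards [this] with r hr
  rw [hr, Polynomial.deriv]

theorem isWeakDeriv_weakDeriv_of_ae_eq_modePoly
    (hf : f =ᵐ[volume.restrict (modeInterval N)] fun r => (modePoly ℓ Q).eval r) :
    IsWeakDeriv (modeInterval N) (weakDeriv (modeInterval N) f)
      fun r => (modePoly ℓ Q).derivative.derivative.eval r := by
  have h1 := weakDeriv_of_ae_eq_modePoly hf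
  rw [modeInterval_eq] at h1 ⊢
  have := isWeakDeriv_deriv (contDiff_polynomial_eval (modePoly ℓ Q).derivative) (modeLeft N) 1
  refine this.congr_ae h1.symm (Eventually.of_forall fun r => ?_)
  simp

theorem radialOp_of_ae_eq_modePoly (hm : 1 < m)
    (hf : f =ᵐ[volume.restrict (modeInterval N)] fun r => (modePoly ℓ Q).eval r) :
    radialOp N ℓ m f =ᵐ[volume.restrict (modeInterval N)]
      fun r => (modePoly ℓ (modeOp N ℓ m Q)).eval r := by
  have h1 := weakDeriv_of_ae_eq_modePoly hf
  have h2 := isWeakDeriv_weakDeriv_of_ae_eq_modePoly hf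
  have h3 := weakDeriv_modeInterval_ae_eq h2
  filter_upwards [hf, h1, h3, ae_ne_zero_modeInterval N] with r e1 e2 e3 ⟨hr, h0⟩
  rw [modePoly_modeOp N ℓ m Q h0, ← mul_barenblatt_rpow hm (modeInterval_subset N hr)]
  simp only [radialOp]
  rw [e1, e2, e3]

theorem memModeSpace_of_ae_eq_modePoly (hN : 1 ≤ N) (hℓ : N = 1 → ℓ ≤ 1) (hm : 1 < m)
    (hf : f =ᵐ[volume.restrict (modeInterval N)] fun r => (modePoly ℓ Q).eval r) :
    MemModeSpace N ℓ m f := by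
  refine ⟨?_, hasModeParity_of_pointwise hf fun _ r _ => modePoly_neg ℓ Q r, ?_⟩
  · rw [modeInterval_eq] at hf ⊢
    exact ((modePoly_contDiff ℓ Q).memSobolevLoc _ _ 1).congr_ae hf.symm
  -- The singular part of the energy density agrees off `0` with a continuous function: either `μ_ℓ
  -- = 0`, or `ℓ ≥ 1` and `r^(2ℓ)` cancels `r²`.
  · have key : ∃ q : ℝ → ℝ, Continuous q ∧ ∀ r, r ≠ 0 →
        sphericalEigenvalue N ℓ / r ^ 2 * (modePoly ℓ Q).eval r ^ 2 = q r := by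
      by_cases hμ : sphericalEigenvalue N ℓ = 0
      · exact ⟨fun _ => 0, continuous_const, fun r _ => by simp [hμ]⟩
      · obtain ⟨_, hℓ1⟩ := sphericalEigenvalue_ne_zero hN hℓ hμ
        refine ⟨fun r => sphericalEigenvalue N ℓ * (r ^ (ℓ - 1) * Q.eval (r ^ 2)) ^ 2,
          by fun_prop, fun r hr => ?_⟩
        obtain ⟨n, rfl⟩ : ∃ n, ℓ = n + 1 := ⟨ℓ - 1, by omega⟩
        rw [modePoly_eval, Nat.add_sub_cancel]
        field_simp
        ring
    obtain ⟨q, hq, hqe⟩ := key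
    have hcont : Continuous fun r => ((modePoly ℓ Q).derivative.eval r ^ 2 + q r) *
        (barenblatt m r * r ^ (N - 1)) :=
      (Continuous.add (by fun_prop) hq).mul (continuous_barenblatt_mul_pow N hm)
    have hsub : modeInterval N ⊆ Icc (modeLeft N) 1 := by
      rw [modeInterval_eq]; exact Ioo_subset_Icc_self
    refine (hcont.integrableOn_Icc.mono_set hsub).congr_fun_ae ?_
    · filter_upwards [hf, weakDeriv_of_ae_eq_modePoly hf, ae_ne_zero_modeInterval N]
        with r e1 e2 ⟨hr, h0⟩
      rw [modeEnergyDensity, e1, e2, hqe r h0]; ring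

theorem asymptoticBC_of_ae_eq_modePoly (hN : 1 ≤ N) (hℓ : N = 1 → ℓ ≤ 1) (hm : 1 < m)
    (hf : f =ᵐ[volume.restrict (modeInterval N)] fun r => (modePoly ℓ Q).eval r) :
    AsymptoticBC N ℓ m f := by
  unfold AsymptoticBC
  intro I flux g hg
  obtain ⟨G, hG, hGp, hT, hc, hi, _⟩ := hg.exists_representative hN hℓ hm
  obtain ⟨h1, h2, h3⟩ := integral_flux_modePoly hN hℓ hm hGp hT hi Q
  have d1 := weakDeriv_of_ae_eq_modePoly hf
  have d2 := isWeakDeriv_flux hm (isWeakDeriv_weakDeriv_of_ae_eq_modePoly hf)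
  have d3 := weakDeriv_modeInterval_ae_eq d2
  have a1 : (fun r => barenblatt m r * r ^ (N - 1) * (modePoly ℓ Q).derivative.eval r *
      weakDeriv I g r) =ᵐ[volume.restrict I]
      fun r => barenblatt m r * weakDeriv I f r * weakDeriv I g r * r ^ (N - 1) := by
    filter_upwards [d1] with r e1
    rw [e1]; ring
  have a2 : (fun r => (fluxWeightDeriv N m r * (modePoly ℓ Q).derivative.eval r
      + barenblatt m r * r ^ (N - 1) * (modePoly ℓ Q).derivative.derivative.eval r) * G r)
      =ᵐ[volume.restrict I] fun r => weakDeriv I flux r * g r := by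
    filter_upwards [d1, d3, hG] with r e1 e2 e3
    rw [e2, e3, e1]
  exact ⟨h1.congr_fun_ae a1, h2.congr_fun_ae a2, by
    rw [← integral_congr_ae a1, ← integral_congr_ae a2]; exact h3⟩

theorem memRadialDomain_of_ae_eq_modePoly (hN : 1 ≤ N) (hℓ : N = 1 → ℓ ≤ 1) (hm : 1 < m)
    (hf : f =ᵐ[volume.restrict (modeInterval N)] fun r => (modePoly ℓ Q).eval r) :
    MemRadialDomain N ℓ m f := by
  refine ⟨?_, memModeSpace_of_ae_eq_modePoly hN hℓ hm hf,
    memModeSpace_of_ae_eq_modePoly hN hℓ hm (radialOp_of_ae_eq_modePoly hm hf),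
    asymptoticBC_of_ae_eq_modePoly hN hℓ hm hf⟩
  rw [modeInterval_eq] at hf ⊢
  exact ((modePoly_contDiff ℓ Q).memSobolevLoc _ _ 3).congr_ae hf.symm

end Smooth

/-! ### Moments determine functions of the right parity. -/

/-- Polynomials in `r²` are uniformly dense on `[0,1]`, as `r ↦ r²` is a homeomorphism there. So `h`
annihilates every test function. -/
theorem ae_eq_zero_of_even_moments {h : ℝ → ℝ} (hi : IntegrableOn h (Ioo 0 1))
    (h0 : ∀ n : ℕ, ∫ r in Ioo 0 1, h r * (r ^ 2) ^ n = 0) :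
    h =ᵐ[volume.restrict (Ioo 0 1)] 0 := by
  have hmul : ∀ q : ℝ → ℝ, Continuous q → IntegrableOn (fun r => h r * q r) (Ioo 0 1) := by
    intro q hq
    obtain ⟨C, hC0, hC⟩ := exists_bound_on_unit hq
    refine Integrable.mul_bdd (c := C) hi hq.aestronglyMeasurable ?_
    refine (ae_restrict_iff' measurableSet_Ioo).2 (Eventually.of_forall fun r hr => ?_)
    exact hC r ⟨by linarith [hr.1], hr.2⟩
  have hP : ∀ P : Polynomial ℝ, ∫ r in Ioo 0 1, h r * P.eval (r ^ 2) = 0 := by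
    intro P
    induction P using Polynomial.induction_on' with
    | add p q hp hq =>
      simp only [Polynomial.eval_add, mul_add]
      rw [integral_add (hmul _ (by fun_prop)) (hmul _ (by fun_prop)), hp, hq, add_zero]
    | monomial n a =>
      simp only [Polynomial.eval_monomial]
      have := h0 n
      simp only [mul_left_comm _ a]
      rw [integral_const_mul, this, mul_zero]
  have := isOpen_Ioo.ae_eq_zero_of_integral_contDiff_smul_eq_zero (μ := volume)
    (U := Ioo 0 1) (f := h) hi.locallyIntegrableOn ?_
  · rw [EventuallyEq, ae_restrict_iff' measurableSet_Ioo]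
    filter_upwards [this] with x hx hxI using hx hxI
  · intro φ hφ _ hs
    have e : ∫ x, φ x • h x = ∫ x in Ioo 0 1, h x * φ x := by
      rw [← setIntegral_eq_integral_of_forall_compl_eq_zero (s := Ioo 0 1)]
      · refine integral_congr_ae (Eventually.of_forall fun x => ?_)
        simp only [smul_eq_mul, mul_comm]
      · intro x hx
        rw [image_eq_zero_of_notMem_tsupport (fun h' => hx (hs h'))]; simp
    rw [e]
    set B := ∫ x in Ioo 0 1, |h x| with hB
    have hB0 : 0 ≤ B := integral_nonneg fun x => abs_nonneg _
    have key : ∀ ε > 0, |∫ x in Ioo 0 1, h x * φ x| ≤ ε * B := by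
      intro ε hε
      -- Approximating `φ(√x)` by `P(x)` is the same as approximating `φ(r)` by `P(r²)`.
      obtain ⟨P, hPε⟩ := exists_polynomial_near_of_continuousOn 0 1 (fun x => φ (√x))
        (hφ.continuous.comp Real.continuous_sqrt).continuousOn ε hε
      have e2 : ∫ x in Ioo 0 1, h x * φ x = ∫ x in Ioo 0 1, h x * (φ x - P.eval (x ^ 2)) := by
        have : ∀ x, h x * (φ x - P.eval (x ^ 2)) = h x * φ x - h x * P.eval (x ^ 2) :=
          fun x => by ring
        simp only [this]
        rw [integral_sub (hmul _ hφ.continuous) (hmul _ (by fun_prop)), hP P, sub_zero]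
      rw [e2, hB, ← integral_const_mul]
      refine abs_integral_le_integral_abs.trans (setIntegral_mono_on ?_ (hi.abs.const_mul ε)
        measurableSet_Ioo fun x hx => ?_)
      · exact (hmul (fun x => φ x - P.eval (x ^ 2)) (hφ.continuous.sub (by fun_prop))).abs
      · have := hPε (x ^ 2) ⟨sq_nonneg x, by nlinarith [hx.1, hx.2]⟩
        rw [Real.sqrt_sq hx.1.le, abs_sub_comm] at this
        rw [abs_mul, mul_comm]
        gcongr
    rcases hB0.eq_or_lt with hz | hpos
    · have := key 1 one_pos
      rw [← hz, mul_zero] at this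
      exact abs_nonpos_iff.1 this
    · by_contra hne
      have h1 : 0 < |∫ x in Ioo 0 1, h x * φ x| := abs_pos.2 hne
      have := key (|∫ x in Ioo 0 1, h x * φ x| / (2 * B)) (by positivity)
      have h2 : |∫ x in Ioo 0 1, h x * φ x| / (2 * B) * B = |∫ x in Ioo 0 1, h x * φ x| / 2 := by
        field_simp
      rw [h2] at this
      linarith

theorem setIntegral_Ioo_neg_one_one_of_even {E : ℝ → ℝ} (hE : ∀ r ∈ Ioo (-1 : ℝ) 1, E (-r) = E r) :
    ∫ r in Ioo (-1 : ℝ) 1, E r = 2 * ∫ r in Ioo (0 : ℝ) 1, E r := by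
  have h1 : ∀ x, (Ioo (-1 : ℝ) 1).indicator E |x| = (Ioo (-1 : ℝ) 1).indicator E x := by
    intro x
    rcases abs_choice x with h | h
    · rw [h]
    · rw [h]
      by_cases hx : x ∈ Ioo (-1 : ℝ) 1
      · rw [indicator_of_mem hx, indicator_of_mem (show -x ∈ Ioo (-1 : ℝ) 1 from
          ⟨by linarith [hx.2], by linarith [hx.1]⟩), hE x hx]
      · rw [indicator_of_notMem hx, indicator_of_notMem]
        exact fun h' => hx ⟨by linarith [h'.2], by linarith [h'.1]⟩
  have h2 := integral_comp_abs (f := (Ioo (-1 : ℝ) 1).indicator E)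
  simp only [h1] at h2
  rw [integral_indicator measurableSet_Ioo, setIntegral_indicator measurableSet_Ioo] at h2
  have h3 : Ioi (0 : ℝ) ∩ Ioo (-1) 1 = Ioo 0 1 := by
    ext x; simp only [mem_inter_iff, mem_Ioi, mem_Ioo]
    constructor
    · rintro ⟨a, b, c⟩; exact ⟨a, c⟩
    · rintro ⟨a, c⟩; exact ⟨a, by linarith, c⟩
  rw [h2, h3]

/-- Continuous functions of the right parity that can be integrated against the weight. -/
structure IsAdmissible (N ℓ : ℕ) (m : ℝ) (F : ℝ → ℝ) : Prop where
  continuousOn : ContinuousOn F (modeInterval N)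
  parity : N = 1 → ∀ r ∈ modeInterval N, F (-r) = (-1) ^ ℓ * F r
  integrable : ∀ q : ℝ → ℝ, Continuous q →
    IntegrableOn (fun r => modeWeight N m r * (F r * q r)) (modeInterval N)

theorem IsAdmissible.sub_const_mul {N ℓ : ℕ} {m : ℝ} {F P : ℝ → ℝ} (hF : IsAdmissible N ℓ m F)
    (hP : IsAdmissible N ℓ m P) (C : ℝ) : IsAdmissible N ℓ m fun r => F r - C * P r := by
  refine ⟨hF.continuousOn.sub (continuousOn_const.mul hP.continuousOn), fun h r hr => ?_,
    fun q hq => ?_⟩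
  · rw [hF.parity h r hr, hP.parity h r hr]; ring
  · refine ((hF.integrable q hq).sub ((hP.integrable q hq).const_mul C)).congr
      (Eventually.of_forall fun r => ?_)
    simp only [Pi.sub_apply]; ring

/-- The moments of `F` with respect to the mode functions `r^(ℓ+2j)`. -/
noncomputable def modeMoment (N ℓ : ℕ) (m : ℝ) (F : ℝ → ℝ) (j : ℕ) : ℝ :=
  ∫ r in modeInterval N, modeWeight N m r * (F r * (modePoly ℓ (Polynomial.X ^ j)).eval r)

theorem modeWeight_neg_one (m r : ℝ) : modeWeight 1 m (-r) = modeWeight 1 m r := by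
  simp [modeWeight]

theorem modeWeight_pos {N : ℕ} {m r : ℝ} (hr : r ∈ Ioo (0 : ℝ) 1) : 0 < modeWeight N m r :=
  mul_pos (Real.rpow_pos_of_pos (one_sub_sq_pos ⟨by linarith [hr.1], hr.2⟩) _) (pow_pos hr.1 _)

/-- For `N = 1` the product of the weight, `F` and `r^(ℓ+2j)` is even, so the moment is twice an
integral over `(0,1)`. There the weight and `r^ℓ` are positive; continuity and parity then give `F =
0` everywhere. -/
theorem IsAdmissible.eq_zero_of_moments {N ℓ : ℕ} {m : ℝ} {F : ℝ → ℝ}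
    (hF : IsAdmissible N ℓ m F) (h : ∀ j, modeMoment N ℓ m F j = 0) :
    ∀ r ∈ modeInterval N, F r = 0 := by
  have hsub := subset_modeInterval N
  have h1 : ∀ j : ℕ, ∫ r in Ioo 0 1, modeWeight N m r * (F r * r ^ ℓ) * (r ^ 2) ^ j = 0 := by
    intro j
    have hj := h j
    have e : ∀ r, modeWeight N m r * (F r * (modePoly ℓ (Polynomial.X ^ j)).eval r) =
        modeWeight N m r * (F r * r ^ ℓ) * (r ^ 2) ^ j := fun r => by
      rw [modePoly_eval, Polynomial.eval_pow, Polynomial.eval_X]; ring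
    unfold modeMoment at hj
    by_cases hN : N = 1
    · subst hN
      have hI : modeInterval 1 = Ioo (-1) 1 := by simp [modeInterval]
      rw [hI, setIntegral_Ioo_neg_one_one_of_even] at hj
      · simp only [e] at hj
        linarith
      · intro r hr
        rw [modePoly_neg, modeWeight_neg_one, hF.parity rfl r (hI ▸ hr)]
        have : ((-1 : ℝ) ^ ℓ) * (-1) ^ ℓ = 1 := by rw [← mul_pow]; simp
        linear_combination (modeWeight 1 m r * (F r * (modePoly ℓ (Polynomial.X ^ j)).eval r)) * this
    · have hI : modeInterval N = Ioo 0 1 := by unfold modeInterval; rw [if_neg hN]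
      rw [hI] at hj
      simpa only [e] using hj
  have h2 := ae_eq_zero_of_even_moments
    (((hF.integrable (fun r => r ^ ℓ) (by fun_prop)).mono_set hsub)) h1
  have h3 : ∀ r ∈ Ioo (0 : ℝ) 1, F r = 0 := by
    refine Measure.eqOn_open_of_ae_eq (μ := volume) (g := fun _ => (0 : ℝ)) ?_ isOpen_Ioo
      (hF.continuousOn.mono hsub) continuousOn_const
    filter_upwards [h2, ae_restrict_mem measurableSet_Ioo] with r hr hrI
    simpa [(modeWeight_pos (N := N) (m := m) hrI).ne', hrI.1.ne'] using hr
  intro r hr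
  by_cases hN : N = 1
  · subst hN
    have hI : modeInterval 1 = Ioo (-1) 1 := by simp [modeInterval]
    refine Measure.eqOn_open_of_ae_eq (μ := volume) (g := fun _ => (0 : ℝ)) ?_
      (isOpen_modeInterval 1) hF.continuousOn continuousOn_const hr
    filter_upwards [ae_ne_zero_modeInterval 1] with t ⟨ht, ht0⟩
    rcases lt_or_gt_of_ne ht0 with hlt | hgt
    · have := hF.parity rfl t ht
      rw [h3 (-t) ⟨by linarith, by linarith [(modeInterval_subset 1 ht).1]⟩] at this
      simpa using this.symm
    · exact h3 t ⟨hgt, (modeInterval_subset 1 ht).2⟩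
  · have hI : modeInterval N = Ioo 0 1 := by unfold modeInterval; rw [if_neg hN]
    exact h3 r (hI ▸ hr)

/-! ### Moment recursion and classification of very weak eigenfunctions. -/

/-- `F` is a very weak solution of `H_ℓ F = lam F`, tested with mode polynomials. -/
def IsVeryWeakEigenfunction (N ℓ : ℕ) (m lam : ℝ) (F : ℝ → ℝ) : Prop :=
  ∀ Q : Polynomial ℝ, ∫ r in modeInterval N, modeWeight N m r *
    (lam * F r * (modePoly ℓ Q).eval r - F r * (modePoly ℓ (modeOp N ℓ m Q)).eval r) = 0

/-- Testing with `r^(ℓ+2j)` involves two moments only, by triangularity. At `j = 0` the right side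
is zero, which starts the induction. -/
theorem IsVeryWeakEigenfunction.moment_recursion {N ℓ : ℕ} {m lam : ℝ} {F : ℝ → ℝ}
    (h : IsVeryWeakEigenfunction N ℓ m lam F) (hF : IsAdmissible N ℓ m F) (j : ℕ) :
    (lam - radialEigenvalue N ℓ j m) * modeMoment N ℓ m F j =
      -(2 * (m - 1) * j * (j + ℓ + (N : ℝ) / 2 - 1)) * modeMoment N ℓ m F (j - 1) := by
  have h1 := h (Polynomial.X ^ j)
  set d := 2 * (m - 1) * j * (j + ℓ + (N : ℝ) / 2 - 1) with hd
  have e : ∀ r, modeWeight N m r * (lam * F r * (modePoly ℓ (Polynomial.X ^ j)).eval r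
      - F r * (modePoly ℓ (modeOp N ℓ m (Polynomial.X ^ j))).eval r) =
      (lam - radialEigenvalue N ℓ j m) *
        (modeWeight N m r * (F r * (modePoly ℓ (Polynomial.X ^ j)).eval r))
      + d * (modeWeight N m r * (F r * (modePoly ℓ (Polynomial.X ^ (j - 1))).eval r)) := by
    intro r
    rw [modeOp_X_pow, ← hd]
    simp only [modePoly_eval, Polynomial.eval_sub, Polynomial.eval_mul, Polynomial.eval_C]
    ring
  simp only [e] at h1
  rw [integral_add ((hF.integrable _ (by fun_prop)).const_mul _)
    ((hF.integrable _ (by fun_prop)).const_mul _), integral_const_mul, integral_const_mul] at h1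
  unfold modeMoment
  linarith

theorem IsVeryWeakEigenfunction.sub_const_mul {N ℓ : ℕ} {m lam : ℝ} {F P : ℝ → ℝ}
    (hF : IsVeryWeakEigenfunction N ℓ m lam F) (hP : IsVeryWeakEigenfunction N ℓ m lam P)
    (aF : IsAdmissible N ℓ m F) (aP : IsAdmissible N ℓ m P) (C : ℝ) :
    IsVeryWeakEigenfunction N ℓ m lam fun r => F r - C * P r := by
  intro Q
  have e : ∀ (F : ℝ → ℝ) (r : ℝ), modeWeight N m r * (lam * F r * (modePoly ℓ Q).eval r
      - F r * (modePoly ℓ (modeOp N ℓ m Q)).eval r) = modeWeight N m r * (F r *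
        (lam * (modePoly ℓ Q).eval r - (modePoly ℓ (modeOp N ℓ m Q)).eval r)) :=
    fun F r => by ring
  have h1 := hF Q
  have h2 := hP Q
  simp only [e] at h1 h2
  have e2 : ∀ r, modeWeight N m r * (lam * (F r - C * P r) * (modePoly ℓ Q).eval r
      - (F r - C * P r) * (modePoly ℓ (modeOp N ℓ m Q)).eval r) = modeWeight N m r * (F r *
        (lam * (modePoly ℓ Q).eval r - (modePoly ℓ (modeOp N ℓ m Q)).eval r)) -
        C * (modeWeight N m r * (P r *
        (lam * (modePoly ℓ Q).eval r - (modePoly ℓ (modeOp N ℓ m Q)).eval r))) :=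
    fun r => by ring
  simp only [e2]
  rw [integral_sub (aF.integrable _ (by fun_prop)) ((aP.integrable _ (by fun_prop)).const_mul C),
    integral_const_mul, h1, h2]
  ring

theorem isTame_modePoly {N : ℕ} (hN : 1 ≤ N) (ℓ : ℕ) {m : ℝ} (hm : 1 < m) (Q : Polynomial ℝ) :
    IsTame N m fun r => (modePoly ℓ Q).eval r := by
  obtain ⟨C, hC0, hC⟩ := exists_bound_on_unit (q := fun r => (modePoly ℓ Q).eval r) (by fun_prop)
  refine ⟨0, C, le_rfl, div_pos one_pos (by linarith), fun r hr => ?_⟩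
  have h1 := hC r (modeInterval_subset N hr)
  have h2 := abs_rpow_le_one hN (modeInterval_subset N hr)
  rw [Real.rpow_zero, mul_one]
  calc _ ≤ 1 * C := by gcongr
    _ = C := one_mul C

theorem isAdmissible_modePoly {N : ℕ} (hN : 1 ≤ N) (ℓ : ℕ) {m : ℝ} (hm : 1 < m)
    (Q : Polynomial ℝ) : IsAdmissible N ℓ m fun r => (modePoly ℓ Q).eval r :=
  have hc : Continuous fun r => (modePoly ℓ Q).eval r := by fun_prop
  ⟨hc.continuousOn, fun _ r _ => modePoly_neg ℓ Q r, fun _ hq =>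
    (isTame_modePoly hN ℓ hm Q).integrableOn_modeWeight_mul hN hc.continuousOn hq⟩

/-- Here `A` stands for `(ρ_* r^(N-1) F')'` and `R` for `H_ℓ F`. When the divergence forms for `F`
and for the polynomial are subtracted, the spherical terms cancel. Keeping `A` and `R` abstract
covers both polynomials and weak eigenfunctions. -/
theorem green_identity {N ℓ : ℕ} (hN : 1 ≤ N) (hℓ : N = 1 → ℓ ≤ 1) {m : ℝ} (hm : 1 < m)
    {F A R : ℝ → ℝ} (hT : IsTame N m F) (hc : ContinuousOn F (modeInterval N))
    (hA : ∀ᵐ r ∂volume.restrict (modeInterval N), A r =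
      sphericalEigenvalue N ℓ / r ^ 2 * (barenblatt m r * r ^ (N - 1)) * F r
        - 2 / (m - 1) * barenblattConst m * (modeWeight N m r * R r))
    (Q : Polynomial ℝ)
    (hi : IntegrableOn (fun r => A r * (modePoly ℓ Q).eval r) (modeInterval N))
    (he : ∫ r in modeInterval N, A r * (modePoly ℓ Q).eval r =
      ∫ r in modeInterval N, (fluxWeightDeriv N m r * (modePoly ℓ Q).derivative.eval r
      + barenblatt m r * r ^ (N - 1) * (modePoly ℓ Q).derivative.derivative.eval r) * F r) :
    ∫ r in modeInterval N, modeWeight N m r *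
      (R r * (modePoly ℓ Q).eval r - F r * (modePoly ℓ (modeOp N ℓ m Q)).eval r) = 0 := by
  have h2 := integrableOn_flux_derivative hN hℓ hm hT hc Q
  rw [← sub_eq_zero, ← integral_sub hi h2] at he
  have hC : 2 / (m - 1) * barenblattConst m ≠ 0 :=
    (mul_pos (div_pos two_pos (by linarith)) (barenblattConst_pos hm)).ne'
  have e : ∫ r in modeInterval N, (A r * (modePoly ℓ Q).eval r -
      (fluxWeightDeriv N m r * (modePoly ℓ Q).derivative.eval r
      + barenblatt m r * r ^ (N - 1) * (modePoly ℓ Q).derivative.derivative.eval r) * F r) =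
      ∫ r in modeInterval N, -(2 / (m - 1) * barenblattConst m) * (modeWeight N m r *
      (R r * (modePoly ℓ Q).eval r - F r * (modePoly ℓ (modeOp N ℓ m Q)).eval r)) := by
    refine integral_congr_ae ?_
    filter_upwards [hA, ae_ne_zero_modeInterval N] with r e1 ⟨hr, h0⟩
    rw [e1, flux_identity hN ℓ hm (modeInterval_subset N hr) h0 ((modePoly ℓ Q).eval r),
      ← modePoly_modeOp N ℓ m Q h0]
    ring
  rw [e, integral_const_mul] at he
  exact (mul_eq_zero.1 he).resolve_left (neg_ne_zero.2 hC)

/-- Symmetry of the operator on mode polynomials: integrate by parts with `P` and `Q` in either role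
and use that the Dirichlet integral is symmetric. -/
theorem green_modePoly {N ℓ : ℕ} (hN : 1 ≤ N) (hℓ : N = 1 → ℓ ≤ 1) {m : ℝ} (hm : 1 < m)
    (P Q : Polynomial ℝ) :
    ∫ r in modeInterval N, modeWeight N m r *
      ((modePoly ℓ (modeOp N ℓ m P)).eval r * (modePoly ℓ Q).eval r
        - (modePoly ℓ P).eval r * (modePoly ℓ (modeOp N ℓ m Q)).eval r) = 0 := by
  have prim : ∀ P : Polynomial ℝ, IsPrimitiveOn (modeInterval N) (fun r => (modePoly ℓ P).eval r)
      (fun r => (modePoly ℓ P).derivative.eval r) := fun P =>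
    IsPrimitiveOn.of_hasDerivAt (ordConnected_modeInterval N)
      (fun x _ => (modePoly ℓ P).hasDerivAt x) (by fun_prop)
  have int : ∀ P : Polynomial ℝ, IntegrableOn (fun r => barenblatt m r * r ^ (N - 1) *
      (modePoly ℓ P).derivative.eval r ^ 2) (modeInterval N) := fun P => by
    have hsub : modeInterval N ⊆ Icc (modeLeft N) 1 := by
      rw [modeInterval_eq]; exact Ioo_subset_Icc_self
    exact (((continuous_barenblatt_mul_pow N hm).mul
      (by fun_prop)).integrableOn_Icc).mono_set hsub
  obtain ⟨_, _, h3⟩ := integral_flux_modePoly hN hℓ hm (prim P) (isTame_modePoly hN ℓ hm P) (int P) Q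
  obtain ⟨_, g2, g3⟩ := integral_flux_modePoly hN hℓ hm (prim Q) (isTame_modePoly hN ℓ hm Q) (int Q) P
  refine green_identity hN hℓ hm (isTame_modePoly hN ℓ hm P) (by fun_prop) ?_ Q g2 ?_
  · filter_upwards [ae_ne_zero_modeInterval N] with r ⟨hr, h0⟩
    rw [flux_identity hN ℓ hm (modeInterval_subset N hr) h0 ((modePoly ℓ P).eval r),
      ← modePoly_modeOp N ℓ m P h0]
  · have : ∫ r in modeInterval N, barenblatt m r * r ^ (N - 1) *
        (modePoly ℓ Q).derivative.eval r * (modePoly ℓ P).derivative.eval r =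
        ∫ r in modeInterval N, barenblatt m r * r ^ (N - 1) *
        (modePoly ℓ P).derivative.eval r * (modePoly ℓ Q).derivative.eval r :=
      integral_congr_ae (Eventually.of_forall fun r => by ring)
    linarith

theorem isVeryWeakEigenfunction_eigenPoly {N ℓ : ℕ} (hN : 1 ≤ N) (hℓ : N = 1 → ℓ ≤ 1) {m : ℝ}
    (hm : 1 < m) (k : ℕ) :
    IsVeryWeakEigenfunction N ℓ m (radialEigenvalue N ℓ k m)
      fun r => (modePoly ℓ (eigenPoly N ℓ k m)).eval r := by
  intro Q
  have := green_modePoly hN hℓ hm (eigenPoly N ℓ k m) Q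
  rw [modeOp_eigenPoly hN ℓ k hm] at this
  rw [← this]
  refine integral_congr_ae (Eventually.of_forall fun r => ?_)
  simp only [modePoly_eval, Polynomial.eval_mul, Polynomial.eval_C]
  ring

/-- As `r` runs through `(0,1)` so does `r²`, so the two polynomials agree at infinitely many
points. -/
theorem eq_of_modePoly_eq_const {ℓ : ℕ} {Q : Polynomial ℝ} {d : ℝ} (hd : ℓ ≠ 0 → d = 0)
    (h : ∀ r ∈ Ioo (0 : ℝ) 1, (modePoly ℓ Q).eval r = d) : Q = Polynomial.C d := by
  have h1 : ∀ x ∈ Ioo (0 : ℝ) 1, Q.eval x = (Polynomial.C d).eval x := by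
    intro x hx
    have hs : √x ∈ Ioo (0 : ℝ) 1 := ⟨Real.sqrt_pos.2 hx.1, by
      rw [Real.sqrt_lt' one_pos]; simpa using hx.2⟩
    have := h _ hs
    rw [modePoly_eval, Real.sq_sqrt hx.1.le] at this
    rw [Polynomial.eval_C]
    rcases eq_or_ne ℓ 0 with h0 | h0
    · simpa [h0] using this
    · rw [hd h0] at this ⊢
      exact (mul_eq_zero.1 this).resolve_left (pow_ne_zero _ hs.1.ne')
  exact Polynomial.eq_of_infinite_eval_eq _ _ ((Ioo_infinite zero_lt_one).mono h1)

theorem IsVeryWeakEigenfunction.classification {N ℓ : ℕ} (hN : 1 ≤ N) (hℓ : N = 1 → ℓ ≤ 1)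
    {m lam : ℝ} (hm : 1 < m) {F : ℝ → ℝ} (h : IsVeryWeakEigenfunction N ℓ m lam F)
    (hF : IsAdmissible N ℓ m F) :
    (∀ r ∈ modeInterval N, F r = 0) ∨ ∃ (k : ℕ) (C : ℝ), lam = radialEigenvalue N ℓ k m ∧
      ∀ r ∈ modeInterval N, F r = C * radialEigenfunction N ℓ k m r := by
  by_cases hlam : ∃ k, lam = radialEigenvalue N ℓ k m
  · right
    obtain ⟨k, hk⟩ := hlam
    have ne : ∀ j, j ≠ k → lam - radialEigenvalue N ℓ j m ≠ 0 := fun j hj h0 =>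
      hj (radialEigenvalue_injective hN ℓ hm (by rw [← hk]; linarith))
    -- The recursion determines every moment from its predecessor except at index `k`, so `M_k` is
    -- the only free parameter.
    have vanish : ∀ F : ℝ → ℝ, IsVeryWeakEigenfunction N ℓ m lam F → IsAdmissible N ℓ m F →
        modeMoment N ℓ m F k = 0 → ∀ r ∈ modeInterval N, F r = 0 := by
      intro F h hF hz
      refine hF.eq_zero_of_moments fun j => ?_
      induction j with
      | zero =>
        by_cases hj : 0 = k
        · rw [hj]; exact hz
        · have := h.moment_recursion hF 0
          simpa [ne 0 hj] using this
      | succ j ih =>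
        by_cases hj : j + 1 = k
        · rw [hj]; exact hz
        · have := h.moment_recursion hF (j + 1)
          rw [Nat.add_sub_cancel, ih, mul_zero] at this
          exact (mul_eq_zero.1 this).resolve_left (ne _ hj)
    have aP := isAdmissible_modePoly hN ℓ hm (eigenPoly N ℓ k m)
    have hP := isVeryWeakEigenfunction_eigenPoly hN hℓ hm k
    rw [← hk] at hP
    -- Otherwise `f_{ℓk}` itself would vanish, contradicting that its polynomial has constant term
    -- one.
    have hMk : modeMoment N ℓ m (fun r => (modePoly ℓ (eigenPoly N ℓ k m)).eval r) k ≠ 0 := by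
      intro h0
      have := vanish _ hP aP h0
      have h2 := eq_of_modePoly_eq_const (fun _ => rfl) fun r hr =>
        this r (subset_modeInterval N hr)
      have h3 := eigenPoly_eval_zero N ℓ k m
      rw [h2] at h3
      simp at h3
    refine ⟨k, modeMoment N ℓ m F k /
      modeMoment N ℓ m (fun r => (modePoly ℓ (eigenPoly N ℓ k m)).eval r) k, hk, fun r hr => ?_⟩
    rw [radialEigenfunction_eq]
    set C := modeMoment N ℓ m F k /
      modeMoment N ℓ m (fun r => (modePoly ℓ (eigenPoly N ℓ k m)).eval r) k with hC
    refine sub_eq_zero.1 (vanish _ (h.sub_const_mul hP hF aP C) (hF.sub_const_mul aP C) ?_ r hr)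
    have e : modeMoment N ℓ m (fun r => F r - C * (modePoly ℓ (eigenPoly N ℓ k m)).eval r) k =
        modeMoment N ℓ m F k -
        C * modeMoment N ℓ m (fun r => (modePoly ℓ (eigenPoly N ℓ k m)).eval r) k := by
      unfold modeMoment
      rw [← integral_const_mul, ← integral_sub (hF.integrable _ (by fun_prop))
        ((aP.integrable _ (by fun_prop)).const_mul C)]
      exact integral_congr_ae (Eventually.of_forall fun r => by ring)
    rw [e, hC, div_mul_cancel₀ _ hMk, sub_self]
  · left
    push Not at hlam
    refine hF.eq_zero_of_moments fun j => ?_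
    have ne : ∀ j, lam - radialEigenvalue N ℓ j m ≠ 0 := fun j => sub_ne_zero.2 (hlam j)
    induction j with
    | zero => simpa [ne 0] using h.moment_recursion hF 0
    | succ j ih =>
      have := h.moment_recursion hF (j + 1)
      rw [Nat.add_sub_cancel, ih, mul_zero] at this
      exact (mul_eq_zero.1 this).resolve_left (ne _)

/-! ### Eigenfunctions of the operator on its domain. -/

/-- The asymptotic boundary condition, with a mode polynomial as test function, performs the first
integration by parts; tameness of the representative `F` permits the second. The constant `c` is
present because for `ℓ = 0` the eigenvalue equation holds only modulo constants. -/
theorem MemRadialDomain.weak_identity {N ℓ : ℕ} (hN : 1 ≤ N) (hℓ : N = 1 → ℓ ≤ 1)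
    {m lam c : ℝ} (hm : 1 < m) {f F : ℝ → ℝ} (hf : MemRadialDomain N ℓ m f)
    (he : ∀ᵐ r ∂volume.restrict (modeInterval N), radialOp N ℓ m f r = lam * f r + c)
    (hF : f =ᵐ[volume.restrict (modeInterval N)] F)
    (hp : IsPrimitiveOn (modeInterval N) F (weakDeriv (modeInterval N) f)) (hT : IsTame N m F)
    (hc : ContinuousOn F (modeInterval N))
    (hi : IntegrableOn (fun r => barenblatt m r * r ^ (N - 1) * weakDeriv (modeInterval N) f r ^ 2)
      (modeInterval N)) (Q : Polynomial ℝ) :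
    ∫ r in modeInterval N, modeWeight N m r *
      ((lam * F r + c) * (modePoly ℓ Q).eval r
        - F r * (modePoly ℓ (modeOp N ℓ m Q)).eval r) = 0 := by
  obtain ⟨⟨_, f₁, hw1, _, f₂, hw2, _⟩, _, _, hbc⟩ := hf
  have d1 := weakDeriv_modeInterval_ae_eq hw1
  have hw2' : IsWeakDeriv (modeInterval N) (weakDeriv (modeInterval N) f) f₂ := by
    rw [modeInterval_eq] at hw2 d1 ⊢
    exact hw2.congr_ae d1.symm (EventuallyEq.refl _ _)
  have d2 := weakDeriv_modeInterval_ae_eq hw2'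
  have d3 := weakDeriv_modeInterval_ae_eq (isWeakDeriv_flux hm hw2')
  have hpm : MemModeSpace N ℓ m fun r => (modePoly ℓ Q).eval r :=
    memModeSpace_of_ae_eq_modePoly hN hℓ hm (EventuallyEq.refl _ _)
  have dp := weakDeriv_of_ae_eq_modePoly (N := N) (ℓ := ℓ) (Q := Q) (EventuallyEq.refl _ _)
  obtain ⟨_, b2, b3⟩ := hbc _ hpm
  obtain ⟨_, _, g3⟩ := integral_flux_modePoly hN hℓ hm hp hT hi Q
  refine green_identity hN hℓ hm hT hc (R := fun r => lam * F r + c) ?_ Q b2 ?_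
  · filter_upwards [d2, d3, hF, he, ae_ne_zero_modeInterval N] with r e2 e3 eF e0 ⟨hr, h0⟩
    rw [e3, flux_identity hN ℓ hm (modeInterval_subset N hr) h0 (f r), ← e2, ← eF, ← e0,
      ← mul_barenblatt_rpow hm (modeInterval_subset N hr)]
    simp only [radialOp]
  · have e : ∫ r in modeInterval N, barenblatt m r * weakDeriv (modeInterval N) f r *
        weakDeriv (modeInterval N) (fun r => (modePoly ℓ Q).eval r) r * r ^ (N - 1) =
        ∫ r in modeInterval N, barenblatt m r * r ^ (N - 1) *
        (modePoly ℓ Q).derivative.eval r * weakDeriv (modeInterval N) f r := by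
      refine integral_congr_ae ?_
      filter_upwards [dp] with r h
      rw [h]; ring
    rw [e, g3] at b3
    exact (neg_injective b3).symm

theorem integrableOn_modeWeight_mul_of_continuous {N : ℕ} (hN : 1 ≤ N) {m : ℝ} (hm : 1 < m)
    {q : ℝ → ℝ} (hq : Continuous q) :
    IntegrableOn (fun r => modeWeight N m r * q r) (modeInterval N) := by
  refine ((isAdmissible_modePoly hN 0 hm 1).integrable q hq).congr
    (Eventually.of_forall fun r => ?_)
  simp [modePoly_eval]

theorem setIntegral_modeWeight_ne_zero {N : ℕ} (hN : 1 ≤ N) {m : ℝ} (hm : 1 < m) :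
    ∫ r in modeInterval N, modeWeight N m r ≠ 0 := by
  intro h0
  have hi : IntegrableOn (modeWeight N m) (modeInterval N) := by
    simpa using integrableOn_modeWeight_mul_of_continuous hN hm (q := fun _ => 1) continuous_const
  have hnn : 0 ≤ᵐ[volume.restrict (modeInterval N)] modeWeight N m :=
    (ae_restrict_iff' (measurableSet_modeInterval N)).2 (Eventually.of_forall fun r hr =>
      mul_nonneg (Real.rpow_nonneg (one_sub_sq_pos_of_mem hr).le _)
        (pow_nonneg_of_mem_modeInterval hN hr))
  have h1 := (setIntegral_eq_zero_iff_of_nonneg_ae hnn hi).1 h0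
  have h2 := Measure.eqOn_open_of_ae_eq h1 (isOpen_modeInterval N)
    ((continuousOn_modeWeight N m).mono (modeInterval_subset N)) continuousOn_const
  have hh : (1 / 2 : ℝ) ∈ Ioo (0 : ℝ) 1 := by norm_num
  exact (modeWeight_pos (N := N) (m := m) hh).ne' (h2 (subset_modeInterval N hh))

theorem IsRadialEigenfunction.classification {N ℓ : ℕ} (hN : 1 ≤ N) (hℓ : N = 1 → ℓ ≤ 1)
    {m lam : ℝ} (hm : 1 < m) {f : ℝ → ℝ} (hf : IsRadialEigenfunction N ℓ m lam f) :
    ∃ (k : ℕ) (C : ℝ), (ℓ, k) ≠ (0, 0) ∧ lam = radialEigenvalue N ℓ k m ∧ C ≠ 0 ∧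
      ModeEq N ℓ f fun r => C * radialEigenfunction N ℓ k m r := by
  obtain ⟨hdom, hne, c₀, hc₀, he⟩ := hf
  obtain ⟨F, hF, hp, hT, hc, hi, hpar⟩ := hdom.2.1.exists_representative hN hℓ hm
  have hw := hdom.weak_identity hN hℓ hm he hF hp hT hc hi
  have aF : IsAdmissible N ℓ m F :=
    ⟨hc, hpar, fun q hq => hT.integrableOn_modeWeight_mul hN hc hq⟩
  -- The constant `c₀` is absorbed by replacing `F` with `F + e`, where `e = c₀ / lam`. For `lam =
  -- 0` and `ℓ = 0`, testing with the constant one gives `c₀` times the total weight equal to zero,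
  -- so `c₀ = 0` already.
  obtain ⟨e, he1, he2⟩ : ∃ e : ℝ, lam * e = c₀ ∧ (ℓ ≠ 0 → e = 0) := by
    rcases eq_or_ne lam 0 with hl | hl
    · refine ⟨0, ?_, fun _ => rfl⟩
      rcases eq_or_ne ℓ 0 with h0 | h0
      · subst h0
        have h1 := hw (Polynomial.C 1)
        rw [modeOp_C] at h1
        simp only [modePoly_eval, Polynomial.eval_C, hl] at h1
        simp only [pow_zero, CharP.cast_eq_zero, zero_mul, mul_one, mul_zero, zero_add,
          sub_zero] at h1
        rw [integral_mul_const] at h1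
        rw [mul_zero, (mul_eq_zero.1 h1).resolve_left (setIntegral_modeWeight_ne_zero hN hm)]
      · rw [hc₀ h0, mul_zero]
    · exact ⟨c₀ / lam, by field_simp, fun h => by rw [hc₀ h, zero_div]⟩
  -- The shift `e` is zero unless `ℓ = 0`, so it may be treated as the mode polynomial of a
  -- constant, which the operator annihilates.
  have hpow : ∀ r : ℝ, e * r ^ ℓ = e := fun r => by
    rcases eq_or_ne ℓ 0 with h0 | h0
    · rw [h0, pow_zero, mul_one]
    · rw [he2 h0, zero_mul]
  have aF' := aF.sub_const_mul (isAdmissible_modePoly hN ℓ hm (Polynomial.C e)) (-1)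
  have hlE : (ℓ : ℝ) * e = 0 := by
    rcases eq_or_ne ℓ 0 with h0 | h0
    · simp [h0]
    · rw [he2 h0, mul_zero]
  have hFe : ∀ r, F r - -1 * (modePoly ℓ (Polynomial.C e)).eval r = F r + e := fun r => by
    rw [modePoly_eval, Polynomial.eval_C, mul_comm (r ^ ℓ), hpow]; ring
  have hvw : IsVeryWeakEigenfunction N ℓ m lam
      fun r => F r - -1 * (modePoly ℓ (Polynomial.C e)).eval r := by
    intro Q
    have h1 := hw Q
    have h2 := green_modePoly hN hℓ hm (Polynomial.C e) Q
    simp only [modeOp_C, hlE, map_zero] at h2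
    have e1 : ∀ r, (modePoly ℓ (Polynomial.C e)).eval r = e := fun r => by
      rw [modePoly_eval, Polynomial.eval_C, mul_comm, hpow]
    have e0 : ∀ r, (modePoly ℓ (0 : Polynomial ℝ)).eval r = 0 := fun r => by simp [modePoly_eval]
    simp only [hFe]
    simp only [e1, e0, zero_mul, zero_sub] at h2
    have i1 : IntegrableOn (fun r => modeWeight N m r * ((lam * F r + c₀) * (modePoly ℓ Q).eval r
        - F r * (modePoly ℓ (modeOp N ℓ m Q)).eval r)) (modeInterval N) := by
      refine ((aF.integrable (fun r => lam * (modePoly ℓ Q).eval r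
        - (modePoly ℓ (modeOp N ℓ m Q)).eval r) (by fun_prop)).add
        (integrableOn_modeWeight_mul_of_continuous hN hm
          (q := fun r => c₀ * (modePoly ℓ Q).eval r) (by fun_prop))).congr
        (Eventually.of_forall fun r => ?_)
      simp only [Pi.add_apply]; ring
    have i2 := integrableOn_modeWeight_mul_of_continuous hN hm
      (q := fun r => -(e * (modePoly ℓ (modeOp N ℓ m Q)).eval r)) (by fun_prop)
    have h3 := integral_add i1 i2
    rw [h1, h2, add_zero] at h3
    rw [← h3]
    refine integral_congr_ae (Eventually.of_forall fun r => ?_)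
    simp only [← he1]; ring
  have zero_of : (∀ᵐ r ∂volume.restrict (modeInterval N), f r = -e) → False := fun h =>
    hne ⟨-e, fun h0 => by rw [he2 h0, neg_zero], by
      filter_upwards [h] with r hr
      simp [hr]⟩
  rcases hvw.classification hN hℓ hm aF' with hz | ⟨k, C, hk, hC⟩
  · refine (zero_of ?_).elim
    filter_upwards [hF, ae_restrict_mem (measurableSet_modeInterval N)] with r h1 hr
    have := hz r hr
    rw [hFe] at this
    rw [h1]; linarith
  · simp only [hFe] at hC
    have hfk : ∀ᵐ r ∂volume.restrict (modeInterval N),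
        f r = C * radialEigenfunction N ℓ k m r + -e := by
      filter_upwards [hF, ae_restrict_mem (measurableSet_modeInterval N)] with r h1 hr
      rw [h1, ← hC r hr]; ring
    refine ⟨k, C, ?_, hk, ?_, -e, fun h0 => by rw [he2 h0, neg_zero], hfk⟩
    -- For `(ℓ,k) = (0,0)` the function would be constant, hence zero in `H¹_0`.
    · rintro h0
      obtain ⟨rfl, rfl⟩ := Prod.mk.inj h0
      refine hne ⟨C + -e, fun h => (h rfl).elim, ?_⟩
      filter_upwards [hfk] with r hr
      rw [hr]
      simp [radialEigenfunction, hypergeometricPoly]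
    · rintro rfl
      refine zero_of ?_
      filter_upwards [hfk] with r hr
      rw [hr]; ring

theorem isRadialEigenfunction_of_modeEq {N ℓ : ℕ} (hN : 1 ≤ N) (hℓ : N = 1 → ℓ ≤ 1)
    {m : ℝ} (hm : 1 < m) {k : ℕ} (hk : (ℓ, k) ≠ (0, 0)) {f : ℝ → ℝ} {c : ℝ} (hc : c ≠ 0)
    (hf : ModeEq N ℓ f fun r => c * radialEigenfunction N ℓ k m r) :
    IsRadialEigenfunction N ℓ m (radialEigenvalue N ℓ k m) f := by
  obtain ⟨c₁, hc₁, hf⟩ := hf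
  set Q : Polynomial ℝ := Polynomial.C c * eigenPoly N ℓ k m + Polynomial.C c₁ with hQ
  have hpow : ∀ r : ℝ, r ^ ℓ * c₁ = c₁ := fun r => by
    rcases eq_or_ne ℓ 0 with h0 | h0
    · rw [h0, pow_zero, one_mul]
    · rw [hc₁ h0, mul_zero]
  have hlc : (ℓ : ℝ) * c₁ = 0 := by
    rcases eq_or_ne ℓ 0 with h0 | h0
    · simp [h0]
    · rw [hc₁ h0, mul_zero]
  have hfQ : f =ᵐ[volume.restrict (modeInterval N)] fun r => (modePoly ℓ Q).eval r := by
    filter_upwards [hf] with r hr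
    rw [hr, radialEigenfunction_eq, modePoly_eval, modePoly_eval, hQ, Polynomial.eval_add,
      Polynomial.eval_mul, Polynomial.eval_C, Polynomial.eval_C, mul_add, hpow]
    ring
  refine ⟨memRadialDomain_of_ae_eq_modePoly hN hℓ hm hfQ, ?_, ?_⟩
  -- If `f` were constant modulo null sets, the eigenpolynomial would be the constant one, so
  -- `λ_{ℓk} = ℓ = λ_{ℓ0}` and `k = 0`. Then `ℓ ≠ 0`, so `d` and `c₁` are zero and the polynomial
  -- would vanish.
  · rintro ⟨d, hd, hfd⟩
    have h1 : EqOn (fun r => (modePoly ℓ Q).eval r) (fun _ => d) (modeInterval N) := by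
      refine Measure.eqOn_open_of_ae_eq (μ := volume) ?_ (isOpen_modeInterval N)
        (by fun_prop) continuousOn_const
      filter_upwards [hfQ, hfd] with r e1 e2
      rw [← e1, e2]; simp
    have h2 : Q = Polynomial.C d :=
      eq_of_modePoly_eq_const hd fun r hr => h1 (subset_modeInterval N hr)
    have h3 : eigenPoly N ℓ k m = Polynomial.C ((d - c₁) / c) := by
      have : Polynomial.C c * eigenPoly N ℓ k m = Polynomial.C (d - c₁) := by
        rw [map_sub, ← h2, hQ]; ring
      calc eigenPoly N ℓ k m = Polynomial.C c⁻¹ * (Polynomial.C c * eigenPoly N ℓ k m) := by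
            rw [← mul_assoc, ← Polynomial.C_mul, inv_mul_cancel₀ hc, Polynomial.C_1, one_mul]
        _ = _ := by rw [this, ← Polynomial.C_mul]; congr 1; field_simp
    have h4 := eigenPoly_eval_zero N ℓ k m
    rw [h3, Polynomial.eval_C] at h4
    have h5 := modeOp_eigenPoly hN ℓ k hm
    rw [h3, h4, modeOp_C, ← Polynomial.C_mul] at h5
    have h6 := Polynomial.C_injective h5
    have h7 : radialEigenvalue N ℓ k m = radialEigenvalue N ℓ 0 m := by
      rw [mul_one, mul_one] at h6
      rw [← h6]; simp [radialEigenvalue]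
    have hk0 := radialEigenvalue_injective hN ℓ hm h7
    have hl0 : ℓ ≠ 0 := fun h => hk (by rw [h, hk0])
    rw [hd hl0, hc₁ hl0] at h4
    simp at h4
  -- The operator kills the additive constant `c₁`, while `λ f` contains `λ c₁`; the difference is a
  -- constant allowed by `ModeEq`.
  · refine ⟨-(radialEigenvalue N ℓ k m * c₁), fun h0 => by rw [hc₁ h0]; simp, ?_⟩
    filter_upwards [radialOp_of_ae_eq_modePoly hm hfQ, hf] with r e1 e2
    rw [e1, e2, radialEigenfunction_eq, hQ, modeOp_add, modeOp_C_mul, modeOp_eigenPoly hN ℓ k hm,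
      modeOp_C, hlc, modePoly_eval, modePoly_eval]
    simp only [Polynomial.eval_add, Polynomial.eval_mul, Polynomial.eval_C]
    ring

/-! ### Classical solutions of the differential equation. -/

theorem IsPrimitiveOn.sub {I : Set ℝ} {G g H h : ℝ → ℝ} (hG : IsPrimitiveOn I G g)
    (hH : IsPrimitiveOn I H h) : IsPrimitiveOn I (fun x => G x - H x) (fun x => g x - h x) := by
  intro x hx y hy
  obtain ⟨h1, h2⟩ := hG x hx y hy
  obtain ⟨h3, h4⟩ := hH x hx y hy
  refine ⟨h1.sub h3, ?_⟩
  rw [intervalIntegral.integral_sub h1 h3, h2, h4]; ring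

theorem not_integrableOn_of_inv_le {u : ℝ → ℝ} {c ε : ℝ} (hε : 0 < ε)
    (hu : ∀ r ∈ Ioo 0 ε, r⁻¹ ≤ c * u r) : ¬ IntegrableOn u (Ioo 0 ε) := by
  intro hi
  have h1 : IntegrableOn (fun r : ℝ => r⁻¹) (Ioo 0 ε) := by
    refine Integrable.mono' (hi.const_mul c) measurable_inv.aestronglyMeasurable ?_
    refine (ae_restrict_iff' measurableSet_Ioo).2 (Eventually.of_forall fun r hr => ?_)
    rw [Real.norm_of_nonneg (inv_nonneg.2 hr.1.le)]
    exact hu r hr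
  have h2 := (intervalIntegrable_iff_integrableOn_Ioo_of_le hε.le).2 h1
  rcases intervalIntegrable_inv_iff.1 h2 with h | h
  · exact hε.ne h
  · exact h left_mem_uIcc

section Classical

variable {N ℓ : ℕ} {m lam : ℝ} {f : ℝ → ℝ}

theorem IsRadialODESolution.regularity (hf : IsRadialODESolution N ℓ m lam f) :
    (∀ r ∈ modeInterval N, HasDerivAt f (deriv f r) r) ∧
    (∀ r ∈ modeInterval N, HasDerivAt (deriv f) (deriv (deriv f) r) r) ∧
    ContinuousOn f (modeInterval N) ∧ ContinuousOn (deriv f) (modeInterval N) ∧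
    ContinuousOn (deriv (deriv f)) (modeInterval N) := by
  have ho := isOpen_modeInterval N
  have h2 : ContDiffOn ℝ (1 + 1) f (modeInterval N) := by
    have := hf.1
    norm_num
    exact this
  obtain ⟨d1, _, h1⟩ := (contDiffOn_succ_iff_deriv_of_isOpen ho).1 h2
  have h1' : ContDiffOn ℝ (0 + 1) (deriv f) (modeInterval N) := by simpa using h1
  obtain ⟨d2, _, h0⟩ := (contDiffOn_succ_iff_deriv_of_isOpen ho).1 h1'
  exact ⟨fun r hr => (d1.differentiableAt (ho.mem_nhds hr)).hasDerivAt,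
    fun r hr => (d2.differentiableAt (ho.mem_nhds hr)).hasDerivAt, d1.continuousOn,
    d2.continuousOn, h0.continuousOn⟩

theorem deriv_neg_of_parity (h : N = 1 → ∀ r ∈ modeInterval N, f (-r) = (-1) ^ ℓ * f r)
    (hN : N = 1) : ∀ r ∈ modeInterval N, deriv f (-r) = -((-1) ^ ℓ * deriv f r) := by
  intro r hr
  have e : (fun x => f (-x)) =ᶠ[𝓝 r] fun x => (-1) ^ ℓ * f x := by
    filter_upwards [(isOpen_modeInterval N).mem_nhds hr] with x hx using h hN x hx
  have h1 := e.deriv_eq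
  rw [deriv_comp_neg, deriv_const_mul_field'] at h1
  linarith

theorem integrableOn_energy_part (hN : 1 ≤ N) (hℓ : N = 1 → ℓ ≤ 1) (hm : 1 < m) {a : ℝ}
    {g : ℝ → ℝ} (hg : AEStronglyMeasurable g (volume.restrict (Ioo 0 a)))
    (h : IntegrableOn (modeEnergyDensity N ℓ m f g) (Ioo 0 a)) :
    IntegrableOn (fun r => barenblatt m r * r ^ (N - 1) * g r ^ 2) (Ioo 0 a) := by
  refine Integrable.mono' h (((continuous_barenblatt_mul_pow N hm).aestronglyMeasurable).mul
    (hg.pow 2)) ((ae_restrict_iff' measurableSet_Ioo).2 (Eventually.of_forall fun r hr => ?_))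
  have hW : 0 ≤ barenblatt m r * r ^ (N - 1) :=
    mul_nonneg (barenblatt_nonneg hm r) (pow_nonneg hr.1.le _)
  have e : modeEnergyDensity N ℓ m f g r = barenblatt m r * r ^ (N - 1) *
      (g r ^ 2 + sphericalEigenvalue N ℓ / r ^ 2 * f r ^ 2) := by
    unfold modeEnergyDensity; ring
  rw [Real.norm_of_nonneg (mul_nonneg hW (sq_nonneg _)), e]
  have hμ := sphericalEigenvalue_nonneg hN hℓ
  have : 0 ≤ sphericalEigenvalue N ℓ / r ^ 2 * f r ^ 2 := by positivity
  exact mul_le_mul_of_nonneg_left (by linarith) hW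

theorem exists_bound_of_tendsto_zero {u : ℝ → ℝ} {a b : ℝ} (hab : a < b)
    (hc : ContinuousOn u (Ico a b)) (h : Tendsto u (𝓝[<] b) (𝓝 0)) :
    ∃ M, ∀ r ∈ Ico a b, |u r| ≤ M := by
  have h1 : ∀ᶠ r in 𝓝[<] b, |u r| < 1 := by
    have := h.abs
    rw [abs_zero] at this
    exact this.eventually_lt_const one_pos
  obtain ⟨d, hd, hd1⟩ := (mem_nhdsLT_iff_exists_Ioo_subset' hab).1 h1
  obtain ⟨C, hC⟩ := isCompact_Icc.exists_bound_of_continuousOn (s := Icc a (max a ((d + b) / 2)))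
    (hc.mono fun x hx => ⟨hx.1, hx.2.trans_lt (max_lt hab (by linarith [mem_Iio.1 hd]))⟩)
  refine ⟨max C 1, fun r hr => ?_⟩
  rcases le_or_gt r d with h2 | h2
  · exact (hC r ⟨hr.1, h2.trans (le_max_of_le_right (by linarith [mem_Iio.1 hd]))⟩).trans
      (le_max_left _ _)
  · exact (hd1 ⟨h2, hr.2⟩ : |u r| < 1).le.trans (le_max_right _ _)

/-- Near `0` the energy controls `f'` as it does in `H¹_ℓ`; near `1` the product `ρ_* f'` is
bounded. Either way the weighted derivative is integrable. -/
theorem IsRadialODESolution.isTame (hN : 1 ≤ N) (hℓ : N = 1 → ℓ ≤ 1) (hm : 1 < m)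
    (hf : IsRadialODESolution N ℓ m lam f)
    (hi : IntegrableOn (modeEnergyDensity N ℓ m f (deriv f)) (Ioo 0 (1 / 2)))
    (ht : Tendsto (fun r => barenblatt m r * deriv f r) (𝓝[<] 1) (𝓝 0)) : IsTame N m f := by
  obtain ⟨hd1, _, hc, hc1, _⟩ := hf.regularity
  have hpar := hasModeParity_pointwise hf.2.1 (EventuallyEq.refl _ _) hc
  have hα : 0 < 1 / (m - 1) := div_pos one_pos (by linarith)
  have hb := barenblattConst_pos hm
  have hs0 : (0 : ℝ) ≤ ((N : ℝ) - 1) / 2 := by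
    have : (1 : ℝ) ≤ N := by exact_mod_cast hN
    linarith
  have hsub := subset_modeInterval N
  -- The first entry makes the squared weight at most a multiple of `ρ_* r^(N-1)`, as needed near
  -- `0`. The second gives `β - 1/(m-1) ≥ -1/2`, so the remaining power is integrable near `1`. Both
  -- are below `1/(m-1)`.
  set β : ℝ := max (1 / (m - 1) / 2) (1 / (m - 1) - 1 / 2) with hβ
  have hβ1 : 1 / (m - 1) / 2 ≤ β := le_max_left _ _
  have hβ2 : 1 / (m - 1) - 1 / 2 ≤ β := le_max_right _ _
  have hβ3 : β < 1 / (m - 1) := max_lt (by linarith) (by linarith)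
  have hp : IsPrimitiveOn (Ioo 0 1) f (deriv f) :=
    IsPrimitiveOn.of_hasDerivAt ordConnected_Ioo (fun r hr => hd1 r (hsub hr)) (hc1.mono hsub)
  have hcont : ContinuousOn (fun r => |r| ^ (((N : ℝ) - 1) / 2) * (1 - r ^ 2) ^ β * deriv f r)
      (Ioo 0 1) :=
    (Continuous.continuousOn ((Continuous.rpow_const (by fun_prop) fun r => Or.inr hs0).mul
      (Continuous.rpow_const (by fun_prop) fun r => Or.inr (by linarith)))).mul (hc1.mono hsub)
  have half : Ioo (0 : ℝ) (1 / 2) ⊆ Ioo 0 1 := Ioo_subset_Ioo_right (by norm_num)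
  have hI : Ico (1 / 2 : ℝ) 1 ⊆ Ioo 0 1 := fun r hr => ⟨by linarith [hr.1], hr.2⟩
  have hint : IntegrableOn (fun r => |r| ^ (((N : ℝ) - 1) / 2) * (1 - r ^ 2) ^ β * deriv f r)
      (Ioo 0 1) := by
    rw [← Ioo_union_Ico_eq_Ioo (show (0 : ℝ) < 1 / 2 by norm_num) (show (1 / 2 : ℝ) ≤ 1 by norm_num),
      integrableOn_union]
    constructor
    · have hE := integrableOn_energy_part hN hℓ hm
        ((hc1.mono (half.trans hsub)).aestronglyMeasurable measurableSet_Ioo) hi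
      refine Integrable.mono' ((hE.const_mul (barenblattConst m)⁻¹).add
        (integrableOn_const (C := (1 : ℝ)) (by simp)))
        ((hcont.mono half).aestronglyMeasurable measurableSet_Ioo) ?_
      refine (ae_restrict_iff' measurableSet_Ioo).2 (Eventually.of_forall fun r hr => ?_)
      have hrI : r ∈ Ioo (-1 : ℝ) 1 := ⟨by linarith [hr.1], by linarith [hr.2]⟩
      have h2 := one_sub_sq_pos hrI
      set S := |r| ^ (((N : ℝ) - 1) / 2) * (1 - r ^ 2) ^ β with hS
      have e : S ^ 2 ≤ (barenblattConst m)⁻¹ * (barenblatt m r * r ^ (N - 1)) := by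
        rw [barenblatt_eq hm hrI, ← abs_of_nonneg (pow_nonneg hr.1.le (N - 1)),
          abs_pow_eq_rpow_mul hN, hS, mul_pow, ← Real.rpow_natCast ((1 - r ^ 2) ^ _) 2,
          ← Real.rpow_mul h2.le]
        have h3 : (1 - r ^ 2) ^ (β * ((2 : ℕ) : ℝ)) ≤ (1 - r ^ 2) ^ (1 / (m - 1)) :=
          Real.rpow_le_rpow_of_exponent_ge h2 (by nlinarith) (by push_cast; linarith)
        have h4 : (barenblattConst m)⁻¹ * (barenblattConst m * (1 - r ^ 2) ^ (1 / (m - 1)) *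
            (|r| ^ (((N : ℝ) - 1) / 2) * |r| ^ (((N : ℝ) - 1) / 2))) =
            (|r| ^ (((N : ℝ) - 1) / 2)) ^ 2 * (1 - r ^ 2) ^ (1 / (m - 1)) := by
          field_simp
        rw [h4]
        gcongr
      simp only [Pi.add_apply]
      rw [Real.norm_eq_abs, ← mul_assoc]
      have h5 : (S * deriv f r) ^ 2 ≤
          (barenblattConst m)⁻¹ * (barenblatt m r * r ^ (N - 1)) * deriv f r ^ 2 := by
        rw [mul_pow]; gcongr
      rw [abs_le]
      constructor <;> nlinarith [sq_nonneg (S * deriv f r + 1), sq_nonneg (S * deriv f r - 1)]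
    · obtain ⟨M, hM⟩ := exists_bound_of_tendsto_zero (show (1 / 2 : ℝ) < 1 by norm_num)
        ((continuous_barenblatt hm).continuousOn.mul (hc1.mono (hI.trans hsub))) ht
      have hi2 := (integrableOn_one_sub_sq_rpow (γ := β - 1 / (m - 1)) (by linarith)).mono_set
        (show Ico (1 / 2 : ℝ) 1 ⊆ Ioo (-1) 1 from fun r hr => ⟨by linarith [hr.1], hr.2⟩)
      refine Integrable.mono' (hi2.const_mul ((barenblattConst m)⁻¹ * M))
        ((hcont.mono hI).aestronglyMeasurable measurableSet_Ico) ?_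
      refine (ae_restrict_iff' measurableSet_Ico).2 (Eventually.of_forall fun r hr => ?_)
      have hrI : r ∈ Ioo (-1 : ℝ) 1 := ⟨by linarith [hr.1], by linarith [hr.2]⟩
      have h2 := one_sub_sq_pos hrI
      have h3 := hM r hr
      have h4 := abs_rpow_le_one hN hrI
      rw [Pi.mul_apply, abs_mul, abs_of_nonneg (barenblatt_nonneg hm r), barenblatt_eq hm hrI] at h3
      have e : (1 - r ^ 2) ^ β = (1 - r ^ 2) ^ (β - 1 / (m - 1)) * (1 - r ^ 2) ^ (1 / (m - 1)) := by
        rw [← Real.rpow_add h2]; congr 1; ring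
      have hx : 0 ≤ |r| ^ (((N : ℝ) - 1) / 2) := Real.rpow_nonneg (abs_nonneg r) _
      have hq := Real.rpow_nonneg h2.le (β - 1 / (m - 1))
      have hq' := Real.rpow_nonneg h2.le (1 / (m - 1))
      rw [Real.norm_eq_abs, abs_mul, abs_mul, abs_of_nonneg hx, e, abs_mul, abs_of_nonneg hq,
        abs_of_nonneg hq']
      calc _ = |r| ^ (((N : ℝ) - 1) / 2) * (barenblattConst m)⁻¹ *
            (1 - r ^ 2) ^ (β - 1 / (m - 1)) *
            (barenblattConst m * (1 - r ^ 2) ^ (1 / (m - 1)) * |deriv f r|) := by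
            field_simp
        _ ≤ 1 * (barenblattConst m)⁻¹ * (1 - r ^ 2) ^ (β - 1 / (m - 1)) * M := by gcongr
        _ = _ := by ring
  obtain ⟨K, hK⟩ := hp.exists_weighted_bound hs0 (β := β) (by linarith) hint
  exact isTame_of_bound (by linarith) hβ3
    (fun h r hr => by rw [hpar h r hr, abs_neg_one_pow_mul]) hK

theorem IsRadialODESolution.radial_eq (hm : 1 < m) (hf : IsRadialODESolution N ℓ m lam f) {r : ℝ}
    (hr : r ∈ modeInterval N) :
    -((m - 1) / 2) * (1 - r ^ 2) * (deriv (deriv f) r + ((N : ℝ) - 1) / r * deriv f r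
          - sphericalEigenvalue N ℓ / r ^ 2 * f r) + r * deriv f r = lam * f r := by
  have h1 := (one_sub_sq_pos_of_mem hr).ne'
  have hm' : m - 1 ≠ 0 := by linarith
  have h := hf.2.2 r hr
  have e : -((m - 1) / 2) * (1 - r ^ 2) * (deriv (deriv f) r + ((N : ℝ) - 1) / r * deriv f r
          - sphericalEigenvalue N ℓ / r ^ 2 * f r) + r * deriv f r - lam * f r =
      -((m - 1) / 2) * (1 - r ^ 2) * (deriv (deriv f) r
        + (((N : ℝ) - 1) / r - 2 / (m - 1) * (r / (1 - r ^ 2))) * deriv f r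
        + (2 * lam / (m - 1) * (1 / (1 - r ^ 2)) - sphericalEigenvalue N ℓ / r ^ 2) * f r) := by
    generalize ((N : ℝ) - 1) / r = y
    generalize sphericalEigenvalue N ℓ / r ^ 2 = z
    field_simp
    ring
  rw [h, mul_zero] at e
  linarith

/-- The weighted Wronskian of `f` and a mode polynomial has derivative a constant multiple of the
tested equation. It suffices that the Wronskian tends to zero at both ends. -/
theorem IsRadialODESolution.isVeryWeakEigenfunction (hN : 1 ≤ N) (hℓ : N = 1 → ℓ ≤ 1)
    (hm : 1 < m) (hf : IsRadialODESolution N ℓ m lam f)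
    (hi : IntegrableOn (modeEnergyDensity N ℓ m f (deriv f)) (Ioo 0 (1 / 2)))
    (ht : Tendsto (fun r => barenblatt m r * deriv f r) (𝓝[<] 1) (𝓝 0)) :
    IsVeryWeakEigenfunction N ℓ m lam f := by
  have hT := hf.isTame hN hℓ hm hi ht
  obtain ⟨hd1, hd2, hc, hc1, hc2⟩ := hf.regularity
  have hpar := hasModeParity_pointwise hf.2.1 (EventuallyEq.refl _ _) hc
  intro Q
  have ho := ordConnected_modeInterval N
  have hW := isPrimitiveOn_fluxWeight N hm
  have pf := IsPrimitiveOn.of_hasDerivAt ho hd1 hc1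
  have pf' := IsPrimitiveOn.of_hasDerivAt ho hd2 hc2
  have pp : IsPrimitiveOn (modeInterval N) (fun r => (modePoly ℓ Q).eval r)
      (fun r => (modePoly ℓ Q).derivative.eval r) :=
    IsPrimitiveOn.of_hasDerivAt ho (fun x _ => (modePoly ℓ Q).hasDerivAt x) (by fun_prop)
  have pp' : IsPrimitiveOn (modeInterval N) (fun r => (modePoly ℓ Q).derivative.eval r)
      (fun r => (modePoly ℓ Q).derivative.derivative.eval r) :=
    IsPrimitiveOn.of_hasDerivAt ho (fun x _ => (modePoly ℓ Q).derivative.hasDerivAt x)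
      (by fun_prop)
  have hΦ := ((hW.mul ho pf').mul ho pp).sub ((hW.mul ho pp').mul ho pf)
  set φ : ℝ → ℝ := fun r => modeWeight N m r *
    (lam * f r * (modePoly ℓ Q).eval r - f r * (modePoly ℓ (modeOp N ℓ m Q)).eval r) with hφ
  have hC : 2 / (m - 1) * barenblattConst m ≠ 0 :=
    (mul_pos (div_pos two_pos (by linarith)) (barenblattConst_pos hm)).ne'
  have hφi : IntegrableOn φ (modeInterval N) := by
    refine (hT.integrableOn_modeWeight_mul hN hc (q := fun r => lam * (modePoly ℓ Q).eval r
      - (modePoly ℓ (modeOp N ℓ m Q)).eval r) (by fun_prop)).congr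
      (Eventually.of_forall fun r => ?_)
    simp only [hφ]; ring
  set φ' : ℝ → ℝ := _ with hφ'
  change IsPrimitiveOn (modeInterval N) _ φ' at hΦ
  have hae : (fun r => -(2 / (m - 1) * barenblattConst m) * φ r)
      =ᵐ[volume.restrict (modeInterval N)] φ' := by
    filter_upwards [ae_ne_zero_modeInterval N] with r ⟨hr, h0⟩
    have e1 := flux_identity hN ℓ hm (modeInterval_subset N hr) h0 (f r) (deriv f r)
      (deriv (deriv f) r)
    have e2 := flux_identity hN ℓ hm (modeInterval_subset N hr) h0 ((modePoly ℓ Q).eval r)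
      ((modePoly ℓ Q).derivative.eval r) ((modePoly ℓ Q).derivative.derivative.eval r)
    rw [hf.radial_eq hm hr] at e1
    rw [← modePoly_modeOp N ℓ m Q h0] at e2
    simp only [hφ', hφ]
    rw [e1, e2]
    ring
  have hφi' : IntegrableOn φ' (modeInterval N) := Integrable.congr (hφi.const_mul _) hae
  have htf := hT.tendsto_flux hN hm (q := fun r => (modePoly ℓ Q).derivative.eval r) (by fun_prop)
  have hfl1 : Tendsto (fun r => barenblatt m r * r ^ (N - 1) * deriv f r * (modePoly ℓ Q).eval r)
      (𝓝[<] 1) (𝓝 0) := by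
    have hq : Continuous fun r : ℝ => r ^ (N - 1) * (modePoly ℓ Q).eval r := by fun_prop
    have := ht.mul (hq.continuousAt (x := 1) |>.tendsto.mono_left nhdsWithin_le_nhds)
    rw [zero_mul] at this
    exact this.congr fun r => by ring
  rw [modeInterval_eq] at hΦ hφi'
  -- The Wronskian has a limit at the left end because its derivative is integrable. Its part with
  -- `f` undifferentiated vanishes there by tameness, so the flux `ρ_* r^(N-1) f' p` has the same
  -- limit `L`.
  obtain ⟨L, hL1, _⟩ := hΦ.exists_tendsto (modeLeft_lt N) hφi'
  have hL2 : Tendsto (fun r => barenblatt m r * r ^ (N - 1) * deriv f r * (modePoly ℓ Q).eval r)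
      (𝓝[>] modeLeft N) (𝓝 L) := by
    have := hL1.add htf.1
    rw [add_zero] at this
    exact this.congr fun r => by ring
  have hL : L = 0 := by
    by_cases hN1 : N = 1
    -- For `N = 1` the flux is odd, as `f` and the polynomial have the same parity, so the limit at
    -- `-1` follows from the one at `1`.
    · subst hN1
      have hl : modeLeft 1 = -1 := by simp [modeLeft]
      rw [hl] at hL2
      have hneg : Tendsto (fun r : ℝ => -r) (𝓝[>] (-1)) (𝓝[<] 1) := by
        simpa using tendsto_neg_nhdsGT (a := (-1 : ℝ))
      have h3 := (hfl1.comp hneg).neg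
      rw [neg_zero] at h3
      refine tendsto_nhds_unique hL2 (h3.congr' ?_)
      have hmem := eventually_mem_nhdsGT_modeLeft 1
      rw [hl] at hmem
      filter_upwards [hmem] with r hr
      simp only [Function.comp_apply]
      rw [barenblatt_neg, modePoly_neg, deriv_neg_of_parity hpar rfl r hr]
      have : ((-1 : ℝ) ^ ℓ) * (-1) ^ ℓ = 1 := by rw [← mul_pow]; simp
      simp only [Nat.sub_self, pow_zero]
      linear_combination (barenblatt m r * deriv f r * (modePoly ℓ Q).eval r) * this
    · have hl : modeLeft N = 0 := by simp [modeLeft, hN1]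
      rw [hl] at hL2
      by_contra hne
      obtain ⟨D, hD0, hD⟩ := exists_bound_on_unit (q := fun r => (modePoly ℓ Q).eval r)
        (by fun_prop)
      obtain ⟨B, hB0, hB⟩ := exists_bound_on_unit (continuous_barenblatt hm)
      -- If `L ≠ 0`, then `|W f'| ≥ c` near `0` with `W = ρ_* r^(N-1)`. Since `W ≤ (B + 1) r` for `N
      -- ≥ 2`, the energy `W f'²` is at least `c² / ((B + 1) r)`, which is not integrable.
      set c := |L| / 2 / (D + 1) with hc
      have hcpos : 0 < c := by have := abs_pos.2 hne; positivity
      have h4 : ∀ᶠ r in 𝓝[>] (0 : ℝ), |L| / 2 <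
          |barenblatt m r * r ^ (N - 1) * deriv f r * (modePoly ℓ Q).eval r| :=
        hL2.abs.eventually_const_lt (by have := abs_pos.2 hne; linarith)
      obtain ⟨d, hd, hd1⟩ := (mem_nhdsGT_iff_exists_Ioo_subset' (zero_lt_one' ℝ)).1 h4
      set ε := min d (1 / 2) with hε
      have hεpos : 0 < ε := lt_min hd (by norm_num)
      have hεhalf : ε ≤ 1 / 2 := min_le_right _ _
      have hsub : Ioo 0 ε ⊆ Ioo (0 : ℝ) (1 / 2) := Ioo_subset_Ioo_right hεhalf
      have hE := (integrableOn_energy_part hN hℓ hm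
        ((hc1.mono ((Ioo_subset_Ioo_right (by norm_num)).trans
          (subset_modeInterval N))).aestronglyMeasurable measurableSet_Ioo) hi).mono_set hsub
      refine not_integrableOn_of_inv_le (c := (B + 1) / c ^ 2) hεpos (fun r hr => ?_) hE
      have hrI : r ∈ Ioo (-1 : ℝ) 1 := ⟨by linarith [hr.1], by linarith [hr.2]⟩
      have h5 : |L| / 2 < |barenblatt m r * r ^ (N - 1) * deriv f r * (modePoly ℓ Q).eval r| :=
        hd1 ⟨hr.1, hr.2.trans_le (min_le_left _ _)⟩
      set W := barenblatt m r * r ^ (N - 1) with hW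
      have hr0 := hr.1
      have hW0 : 0 ≤ W := mul_nonneg (barenblatt_nonneg hm r) (pow_nonneg hr.1.le _)
      have hW1 : W ≤ (B + 1) * r := by
        have e1 : barenblatt m r ≤ B + 1 := by linarith [(le_abs_self _).trans (hB r hrI)]
        have e2 : r ^ (N - 1) ≤ r := pow_le_of_le_one hr.1.le hrI.2.le (by omega)
        have := barenblatt_nonneg hm r
        calc W ≤ (B + 1) * r ^ (N - 1) := by simp only [hW]; gcongr
          _ ≤ (B + 1) * r := by gcongr
      have h6 : c ≤ |W * deriv f r| := by
        rw [abs_mul] at h5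
        have e1 : |(modePoly ℓ Q).eval r| ≤ D + 1 := by linarith [hD r hrI]
        have e2 : |L| / 2 ≤ |W * deriv f r| * (D + 1) :=
          h5.le.trans (by gcongr)
        rw [hc, div_le_iff₀ (by linarith)]
        exact e2
      have h7 : c ^ 2 ≤ (W * deriv f r) ^ 2 := by
        rw [← sq_abs (W * deriv f r)]; gcongr
      have h8 : c ^ 2 ≤ (B + 1) * r * (W * deriv f r ^ 2) := by
        calc c ^ 2 ≤ W * (W * deriv f r ^ 2) := by linarith
          _ ≤ _ := by gcongr
      rw [inv_eq_one_div, div_le_iff₀ hr0, div_mul_eq_mul_div, div_mul_eq_mul_div,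
        le_div_iff₀ (by positivity)]
      linarith
  rw [hL] at hL1
  have hR : Tendsto (fun r => barenblatt m r * r ^ (N - 1) * deriv f r * (modePoly ℓ Q).eval r -
      barenblatt m r * r ^ (N - 1) * (modePoly ℓ Q).derivative.eval r * f r) (𝓝[<] 1) (𝓝 0) := by
    have := hfl1.sub htf.2
    rw [sub_zero] at this
    exact this.congr fun r => by ring
  have h0 := hΦ.setIntegral_eq_zero (modeLeft_lt N) hφi' hL1 hR
  rw [← modeInterval_eq, ← integral_congr_ae hae, integral_const_mul] at h0
  exact (mul_eq_zero.1 h0).resolve_left (neg_ne_zero.2 hC)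

end Classical

theorem proposition3 (N ℓ : ℕ) (m : ℝ) (hN : 1 ≤ N) (hℓ : N = 1 → ℓ ≤ 1) (hm : 1 < m) :
    -- the eigenvalues are exactly the `λ_{ℓk}` with `(ℓ,k) ≠ (0,0)`
    (∀ lam : ℝ, IsRadialEigenvalue N ℓ m lam ↔
      ∃ k : ℕ, (ℓ, k) ≠ (0, 0) ∧ lam = radialEigenvalue N ℓ k m) ∧
    -- the eigenfunctions for `λ_{ℓk}` are exactly the nonzero multiples of `f_{ℓk}` in `H¹_ℓ`
    (∀ k : ℕ, (ℓ, k) ≠ (0, 0) → ∀ f : ℝ → ℝ,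
      (IsRadialEigenfunction N ℓ m (radialEigenvalue N ℓ k m) f ↔
        ∃ c : ℝ, c ≠ 0 ∧ ModeEq N ℓ f (fun r => c * radialEigenfunction N ℓ k m r))) ∧
    -- every other nontrivial solution of the ODE fails integrability at `0` or the boundary condition at `1`
    (∀ (lam : ℝ) (f : ℝ → ℝ), IsRadialODESolution N ℓ m lam f →
      (∃ r ∈ modeInterval N, f r ≠ 0) →
      (¬ ∃ (k : ℕ) (c : ℝ), lam = radialEigenvalue N ℓ k m ∧
        ∀ r ∈ modeInterval N, f r = c * radialEigenfunction N ℓ k m r) →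
      (¬ IntegrableOn (modeEnergyDensity N ℓ m f (deriv f)) (Ioo 0 (1 / 2)) ∨
        ¬ Tendsto (fun r => barenblatt m r * deriv f r) (𝓝[<] 1) (𝓝 0))) := by
  refine ⟨fun lam => ⟨?_, ?_⟩, fun k hk f => ⟨fun hf => ?_, ?_⟩, fun lam f hf hne hno => ?_⟩
  · rintro ⟨f, hf⟩
    obtain ⟨k, _, hk, hlam, _⟩ := hf.classification hN hℓ hm
    exact ⟨k, hk, hlam⟩
  · rintro ⟨k, hk, rfl⟩
    exact ⟨_, isRadialEigenfunction_of_modeEq hN hℓ hm hk one_ne_zero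
      ⟨0, fun _ => rfl, Eventually.of_forall fun r => (add_zero _).symm⟩⟩
  · obtain ⟨j, C, _, hlam, hC, hM⟩ := hf.classification hN hℓ hm
    obtain rfl := radialEigenvalue_injective hN ℓ hm hlam
    exact ⟨C, hC, hM⟩
  · rintro ⟨c, hc, hM⟩
    exact isRadialEigenfunction_of_modeEq hN hℓ hm hk hc hM
  · by_contra hcon
    rw [not_or, not_not, not_not] at hcon
    have hT := hf.isTame hN hℓ hm hcon.1 hcon.2
    have hc := hf.regularity.2.2.1
    rcases (hf.isVeryWeakEigenfunction hN hℓ hm hcon.1 hcon.2).classification hN hℓ hm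
      ⟨hc, hasModeParity_pointwise hf.2.1 (EventuallyEq.refl _ _) hc,
        fun q hq => hT.integrableOn_modeWeight_mul hN hc hq⟩ with h | h
    · obtain ⟨r, hr, h0⟩ := hne
      exact h0 (h r hr)
    · exact hno h
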